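/- Let $\mathcal{A}$ be a finite set of linear hyperplanes in a finite-dimensional real vector space $V$ (a real central arrangement). Its faces are the strata into which it divides $V$, its chambers are the faces that meet no hyperplane of $\mathcal{A}$, and its tope graph has the chambers as vertices, two chambers being adjacent when exactly one hyperplane separates them. Let $L(\mathcal{A})$ be the lattice of flats, i.e. of all intersections of subsets of $\mathcal{A}$ (including $V$ itself), ordered by reverse inclusion. For a flat $X$ put $\operatorname{rank}X=\operatorname{codim}X$ and $\mathcal{A}_X=\{H\in\mathcal{A}\mid X\subseteq H\}$, and let $c^X$ be the number of faces whose linear span is $X$. A flat $X$ is called Boolean if $\operatorname{rank}X=\#\mathcal{A}_X$. Let $MH_{k,\ell}(\mathcal{A})$ be the magnitude homology of the tope graph, with integer coefficients, and $\beta_{k,\ell}(\mathcal{A})$ its rank. Binomial coefficients with negative lower index are $0$. (1) For all $\ell\ge 0$ the group $MH_{\ell,\ell}(\mathcal{A})$ is free abelian of finite rank $\beta_{\ell,\ell}(\mathcal{A})$. (2) For all $\ell\ge 1$, \[ \beta_{\ell,\ell}(\mathcal{A})=\sum_{\substack{X\in L(\mathcal{A})\\ \operatorname{rank}X=\#\mathcal{A}_X}}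 c^X\cdot 2^{\operatorname{rank}X}\binom{\ell-1}{\operatorname{rank}X-1}. \] (3) For every $\ell\ge 0$, $\beta_{\ell,\ell}(\mathcal{A})$ is determined by the intersection lattice: arrangements with isomorphic intersection lattices have the same $\beta_{\ell,\ell}$. (4) If $\mathcal{A}$ is non-empty, then there is a polynomial $p\in\mathbb{Q}[t]$ of degree exactly $d_{\max}-1$, where $d_{\max}=\max\{\operatorname{rank}X\mid X\in L(\mathcal{A}),\ \operatorname{rank}X=\#\mathcal{A}_X\}$, such that $\beta_{\ell,\ell}(\mathcal{A})=p(\ell)$ for all $\ell\ge 1$. (5) Let $Bl_d$ be the arrangement of the $d$ coordinate hyperplanes in $\mathbb{R}^d$ ($d\ge 0$), and let $MH^\circ_{k,\ell}(Bl_d)$ be its interior magnitude homology, i.e. the homology of the subcomplex of the magnitude complex spanned by the proper chains of chambers $(x_0,\dots,x_k)$ of length $\ell$ such that the hyperplanes separating consecutive chambers $x_i,x_{i+1}$ intersect, over all $i$, exactly in the center $\{0\}$. For all $\ell\ge1$ the group $MH^\circ_{\ell,\ell}(Bl_d)$ is free abelian of finite rank \[ \beta^\circ_{\ell,\ell}(Bl_d)=2^d\binom{\ell-1}{d-1}.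 \] -/

import Mathlib

/-! ### Magnitude homology of a graph -/

namespace MagnitudeHomology

variable {W : Type*} (G : SimpleGraph W)

/-- A tuple `(x_0, …, x_k)` is a proper chain if adjacent nodes are distinct. -/
def IsProper {k : ℕ} (x : Fin (k + 1) → W) : Prop :=
  ∀ i : Fin k, x i.castSucc ≠ x i.succ

/-- The length `d(x_0, x_1) + ⋯ + d(x_{k-1}, x_k)` for the (extended) graph distance. -/
noncomputable def length {k : ℕ} (x : Fin (k + 1) → W) : ℕ∞ :=
  ∑ i : Fin k, G.edist (x i.castSucc) (x i.succ)

/-- The set `P_{k,ℓ}(G)` of proper `k`-chains of length `ℓ`. -/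
def properChains (ℓ k : ℕ) : Set (Fin (k + 1) → W) :=
  {x | IsProper x ∧ length G x = (ℓ : ℕ∞)}

open Classical in
/-- The operator `∂_{j+1}` on a `(k+1)`-chain: it deletes the interior node `x_{j+1}` if
`d(x_j, x_{j+2}) = d(x_j, x_{j+1}) + d(x_{j+1}, x_{j+2})`, and gives `0` otherwise. -/
noncomputable def deleteNode {k : ℕ} (j : Fin k) (x : Fin (k + 2) → W) :
    (Fin (k + 1) → W) →₀ ℤ :=
  if G.edist (x j.castSucc.castSucc) (x j.succ.succ) =
      G.edist (x j.castSucc.castSucc) (x j.succ.castSucc) +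
        G.edist (x j.succ.castSucc) (x j.succ.succ)
  then Finsupp.single (fun i => x (j.succ.castSucc.succAbove i)) 1
  else 0

/-- The boundary operator `∂ = ∑_{i=1}^{k} (-1)^{i-1} ∂_i` on `(k+1)`-chains
(the summation index below is `j = i - 1`). -/
noncomputable def boundary (k : ℕ) :
    ((Fin (k + 2) → W) →₀ ℤ) →ₗ[ℤ] ((Fin (k + 1) → W) →₀ ℤ) :=
  Finsupp.linearCombination ℤ fun x => ∑ j : Fin k, (-1 : ℤ) ^ (j : ℕ) • deleteNode G j x

/-- The free abelian group on a set `P k` of `k`-chains. -/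
noncomputable def chains (P : ∀ k : ℕ, Set (Fin (k + 1) → W)) (k : ℕ) :
    Submodule ℤ ((Fin (k + 1) → W) →₀ ℤ) :=
  Finsupp.supported ℤ ℤ (P k)

/-- The `k`-cycles among the chains spanned by `P`. -/
noncomputable def cycles (P : ∀ k : ℕ, Set (Fin (k + 1) → W)) :
    ∀ k : ℕ, Submodule ℤ ((Fin (k + 1) → W) →₀ ℤ)
  | 0 => chains P 0
  | k + 1 => chains P (k + 1) ⊓ LinearMap.ker (boundary G k)

/-- The boundaries of the `(k+1)`-chains spanned by `P`. -/
noncomputable def boundaries (P : ∀ k : ℕ, Set (Fin (k + 1) → W)) (k : ℕ) :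
    Submodule ℤ ((Fin (k + 1) → W) →₀ ℤ) :=
  (chains P (k + 1)).map (boundary G k)

/-- The `k`-th homology (cycles modulo boundaries) of the complex of chains spanned by `P`. -/
abbrev Homology (P : ∀ k : ℕ, Set (Fin (k + 1) → W)) (k : ℕ) : Type _ :=
  ↥(cycles G P k) ⧸ (boundaries G P k).submoduleOf (cycles G P k)

/-- The magnitude homology group `MH_{k,ℓ}(G)`. -/
abbrev MH (k ℓ : ℕ) : Type _ := Homology G (properChains G ℓ) k

end MagnitudeHomology

/-! ### Real central hyperplane arrangements -/

/-- A real central hyperplane arrangement in `V`: a finite set of linear hyperplanes. -/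
structure RealArrangement (V : Type*) [AddCommGroup V] [Module ℝ V] where
  /-- the hyperplanes -/
  hyperplanes : Finset (Submodule ℝ V)
  codim_eq_one : ∀ H ∈ hyperplanes, Module.finrank ℝ (V ⧸ H) = 1

namespace RealArrangement

variable {V : Type*} [AddCommGroup V] [Module ℝ V] (A : RealArrangement V)

/-- Two points lie in the same face iff, for every hyperplane of the arrangement, the linear
forms defining this hyperplane have the same sign (`-`, `0` or `+`) at the two points. -/
def faceSetoid : Setoid V where
  r x y := ∀ H ∈ A.hyperplanes, ∀ f : Module.Dual ℝ V, LinearMap.ker f = H →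
    SignType.sign (f x) = SignType.sign (f y)
  iseqv :=
    ⟨fun _ _ _ _ _ => rfl, fun h H hH f hf => (h H hH f hf).symm,
      fun h₁ h₂ H hH f hf => (h₁ H hH f hf).trans (h₂ H hH f hf)⟩

/-- The faces of the arrangement: the strata into which it divides `V`. -/
def Face : Type _ := Quotient A.faceSetoid

variable {A} in
/-- The set of points of a face. -/
def Face.carrier (F : A.Face) : Set V := {x | Quotient.mk A.faceSetoid x = F}

variable {A} in
/-- The support of a face: the smallest linear subspace containing it. -/
def Face.support (F : A.Face) : Submodule ℝ V := Submodule.span ℝ F.carrier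

/-- The chambers: the faces that do not meet any hyperplane of the arrangement. -/
def Chamber : Type _ := {F : A.Face // ∀ H ∈ A.hyperplanes, Disjoint F.carrier (H : Set V)}

variable {A} in
/-- The set of points of a chamber. -/
def Chamber.carrier (C : A.Chamber) : Set V := Face.carrier C.1

variable {A} in
/-- The hyperplane `H` separates `C` and `D`: they lie on opposite sides of `H`. -/
def Separates (H : Submodule ℝ V) (C D : A.Chamber) : Prop :=
  ∃ f : Module.Dual ℝ V, LinearMap.ker f = H ∧
    (∀ x ∈ C.carrier, f x < 0) ∧ (∀ y ∈ D.carrier, 0 < f y)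

theorem Separates.symm {H : Submodule ℝ V} {C D : A.Chamber} (h : Separates H C D) :
    Separates H D C := by
  obtain ⟨f, hf, h₁, h₂⟩ := h
  refine ⟨-f, ?_, fun x hx => ?_, fun y hy => ?_⟩
  · rw [← hf]; ext v; simp
  · simpa using h₂ x hx
  · simpa using h₁ y hy

theorem separates_comm (H : Submodule ℝ V) (C D : A.Chamber) :
    Separates H C D ↔ Separates H D C :=
  ⟨fun h => h.symm, fun h => h.symm⟩

theorem not_separates_self (H : Submodule ℝ V) (C : A.Chamber) : ¬ Separates H C C := by
  rintro ⟨f, -, h₁, h₂⟩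
  obtain ⟨x, hx⟩ := Quotient.exists_rep C.1
  exact lt_asymm (h₁ x hx) (h₂ x hx)

open Classical in
/-- The set `S(C, D)` of hyperplanes of the arrangement that separate `C` and `D`. -/
noncomputable def sep (C D : A.Chamber) : Finset (Submodule ℝ V) :=
  A.hyperplanes.filter fun H => Separates H C D

theorem sep_comm (C D : A.Chamber) : A.sep C D = A.sep D C := by
  classical
  unfold sep
  exact Finset.filter_congr fun H _ => separates_comm A H C D

theorem sep_self (C : A.Chamber) : A.sep C C = ∅ := by
  classical
  unfold sep
  exact Finset.filter_eq_empty_iff.2 fun H _ => not_separates_self A H C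

/-- The tope graph: its vertices are the chambers, and two chambers are adjacent if exactly one
hyperplane separates them. -/
def topeGraph : SimpleGraph A.Chamber where
  Adj C D := (A.sep C D).card = 1
  symm := ⟨fun C D h => by rw [A.sep_comm]; exact h⟩
  loopless := ⟨fun C h => by rw [A.sep_self] at h; simp at h⟩

/-- The magnitude homology `MH_{k,ℓ}` of the arrangement, i.e. of its tope graph. -/
abbrev MH (k ℓ : ℕ) : Type _ := MagnitudeHomology.MH A.topeGraph k ℓ

/-- The magnitude Betti number `β_{k,ℓ} = rank MH_{k,ℓ}`. -/
noncomputable def beta (k ℓ : ℕ) : ℕ := Module.finrank ℤ (A.MH k ℓ)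

open Classical in
/-- The set of hyperplanes crossed by a chain of chambers: the union of the sets
`S(x_i, x_{i+1})`. -/
noncomputable def crossed {k : ℕ} (x : Fin (k + 1) → A.Chamber) : Finset (Submodule ℝ V) :=
  Finset.univ.biUnion fun i : Fin k => A.sep (x i.castSucc) (x i.succ)

/-- The proper `k`-chains of length `ℓ` for which the intersection of the crossed hyperplanes is
the center of the arrangement. They span the interior magnitude complex: the direct sum, over the
subarrangements `B` with `⋂ B = ⋂ A`, of the groups spanned by the chains crossing exactly `B`. -/
def interiorChains (ℓ k : ℕ) : Set (Fin (k + 1) → A.Chamber) :=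
  {x | x ∈ MagnitudeHomology.properChains A.topeGraph ℓ k ∧
    (A.crossed x).inf id = A.hyperplanes.inf id}

/-- The interior magnitude homology `MH°_{k,ℓ}` of the arrangement. -/
abbrev interiorMH (k ℓ : ℕ) : Type _ :=
  MagnitudeHomology.Homology A.topeGraph (A.interiorChains ℓ) k

/-- The interior magnitude Betti number `β°_{k,ℓ}`. -/
noncomputable def interiorBeta (k ℓ : ℕ) : ℕ := Module.finrank ℤ (A.interiorMH k ℓ)

open Classical in
/-- The elements of the intersection lattice `L(A)` (flats): all intersections of subsets of the
arrangement; the empty intersection is `V`. -/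
noncomputable def flats : Finset (Submodule ℝ V) :=
  A.hyperplanes.powerset.image fun B => B.inf id

/-- The rank of a flat: its codimension. -/
noncomputable def rank (X : Submodule ℝ V) : ℕ := Module.finrank ℝ (V ⧸ X)

open Classical in
/-- The localization `A_X`: the hyperplanes of the arrangement that contain `X`. -/
noncomputable def localization (X : Submodule ℝ V) : Finset (Submodule ℝ V) :=
  A.hyperplanes.filter fun H => X ≤ H

/-- The Boolean flats: the flats `X` with `rank X = #A_X`. -/
noncomputable def booleanFlats : Finset (Submodule ℝ V) :=
  A.flats.filter fun X => rank X = (A.localization X).card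

/-- The number `c^X` of faces with support `X`. -/
noncomputable def faceCount (X : Submodule ℝ V) : ℕ := Nat.card {F : A.Face // F.support = X}

/-- The largest rank of a Boolean flat. -/
noncomputable def dMax : ℕ := A.booleanFlats.sup rank

/-- The Boolean arrangement: the coordinate hyperplanes of `ℝ^d`. -/
noncomputable def boolean (d : ℕ) : RealArrangement (Fin d → ℝ) where
  hyperplanes := by
    classical
    exact Finset.univ.image fun i : Fin d => LinearMap.ker (LinearMap.proj (R := ℝ) i)
  codim_eq_one := by
    classical
    intro H hH
    obtain ⟨i, -, rfl⟩ := Finset.mem_image.1 hH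
    have hs : Function.Surjective (LinearMap.proj (R := ℝ) (φ := fun _ : Fin d => ℝ) i) :=
      LinearMap.proj_surjective i
    exact (LinearEquiv.finrank_eq (LinearMap.quotKerEquivOfSurjective _ hs)).trans
      (Module.finrank_self ℝ)

end RealArrangement

/-- The binomial coefficient with integer lower index; it is `0` if the lower index is
negative. -/
def binom (n : ℕ) (k : ℤ) : ℕ := if k < 0 then 0 else n.choose k.toNat

/-! A proper chain with ℓ steps and length ℓ is a walk along edges, and no chain of length ℓ has ℓ +
1 steps. Diagonal homology is therefore the group of cycles, with nothing to divide out. Recording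
chambers as sign vectors mod 2 makes the tope graph an induced subgraph of a hypercube, and a walk
becomes a starting chamber u together with the word w of hyperplanes crossed.

Deleting a node contributes exactly when its two neighbouring letters differ, and the result forgets
only the order of these two letters. So a chain is a cycle iff its coefficients are antisymmetric
under swapping adjacent distinct letters, words that are not walks having coefficient 0
(`boundary_eq_zero_iff`). Twisting by the sign of the stable sorting permutation turns this into
invariance under all permutations (`mem_cycles_iff`). A cycle is then an arbitrary integer function
of pairs (u, multiset m) such that every rearrangement of m is a walk from u, i.e. such that the
whole cube at u in the directions supp m consists of chambers (`exists_cycles_equiv`). This gives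
freeness. The rank is a sum over supports B of the number of cubes times the number of multisets of
size ℓ with support B.

Geometry counts the cubes. By convexity a cube in the directions B has a centre: a point lying on
exactly the hyperplanes of B. Its sign vectors force the forms of B to be independent, so X = ⋂ B is
a Boolean flat with A_X = B. Conversely, each face with support X and each choice of signs on B
gives a chamber by perturbation, whence c^X · 2^{rank X} (`card_cubeAt`).

For lattice invariance, c^X is a signed sum over sets of hyperplanes involving only ranks of flats
(Whitney, by deletion and restriction), and rank is a lattice invariant. For polynomial growth, the
binomials are polynomials in ℓ with positive leading coefficients. The interior complex only
restricts the support B, so the same argument applies; for coordinate hyperplanes the only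
admissible B is the whole arrangement. -/

namespace MagnitudeHomology

/-! ### Walks in an induced subgraph of a hypercube and the boundary in terms of words. -/

section Hypercube

variable {W ι : Type*} [DecidableEq ι] (p : W → ι → ZMod 2)

/-- Consecutive nodes of the chain `x` differ exactly in the coordinates listed by `w`. -/
def Trace {k : ℕ} (x : Fin (k + 1) → W) (w : Fin k → ι) : Prop :=
  ∀ i : Fin k, p (x i.succ) = p (x i.castSucc) + Pi.single (w i) 1

theorem ite_castSucc_lt_succ {M : Type*} [AddMonoid M] {k : ℕ} (i m : Fin k) (a : M) :
    (if m.castSucc < i.succ then a else 0) =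
      (if m.castSucc < i.castSucc then a else 0) + if m = i then a else 0 := by
  rcases lt_trichotomy m i with hm | rfl | hm
  · have hm' : (m : ℕ) < i := hm
    rw [if_pos (show m.castSucc < i.succ from Nat.lt_succ_of_lt hm'),
      if_pos (show m.castSucc < i.castSucc from hm'), if_neg hm.ne, add_zero]
  · rw [if_pos (show m.castSucc < m.succ from Nat.lt_succ_self _), if_neg (lt_irrefl _),
      if_pos rfl, zero_add]
  · have hm' : (i : ℕ) < m := hm
    rw [if_neg (show ¬ m.castSucc < i.succ from fun h => by
        have : (m : ℕ) < i + 1 := h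
        omega),
      if_neg (show ¬ m.castSucc < i.castSucc from fun h => by
        have : (m : ℕ) < i := h
        omega), if_neg hm.ne', add_zero]

theorem single_one_injective {a b : ι} (h : (Pi.single a 1 : ι → ZMod 2) = Pi.single b 1) :
    a = b := by
  by_contra hab
  have := congr_fun h a
  simp [hab] at this

theorem single_add_single_ne_zero {a b : ι} (hab : a ≠ b) :
    (Pi.single a 1 + Pi.single b 1 : ι → ZMod 2) ≠ 0 := by
  intro h
  have := congr_fun h a
  simp [hab] at this

theorem single_add_single_ne_single {a b c : ι} (hab : a ≠ b) :
    (Pi.single a 1 + Pi.single b 1 : ι → ZMod 2) ≠ Pi.single c 1 := by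
  intro h
  have h1 : a = c := by
    by_contra hc
    have := congr_fun h a
    simp [hab, hc] at this
  have h2 : b = c := by
    by_contra hc
    have := congr_fun h b
    simp [hab.symm, hc] at this
  exact hab (h1.trans h2.symm)

theorem add_self_zmod_two {κ : Type*} (z : κ → ZMod 2) : z + z = 0 := by
  ext i
  exact CharTwo.add_self_eq_zero (z i)

theorem single_add_single_eq {a b c d : ι} (hab : a ≠ b)
    (h : (Pi.single a 1 + Pi.single b 1 : ι → ZMod 2) = Pi.single c 1 + Pi.single d 1) :
    (a = c ∧ b = d) ∨ (a = d ∧ b = c) := by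
  have h1 : a = c ∨ a = d := by
    by_contra! hc
    have := congr_fun h a
    simp [hab, hc.1, hc.2] at this
  rcases h1 with rfl | rfl
  · exact Or.inl ⟨rfl, single_one_injective (add_left_cancel h)⟩
  · rw [add_comm (Pi.single c 1)] at h
    exact Or.inr ⟨rfl, single_one_injective (add_left_cancel h)⟩

variable {p}

theorem Trace.word_unique {k : ℕ} {x : Fin (k + 1) → W} {w w' : Fin k → ι} (h : Trace p x w)
    (h' : Trace p x w') : w = w' := by
  ext i
  exact single_one_injective (add_left_cancel ((h i).symm.trans (h' i)))

theorem Trace.chain_unique (hp : Function.Injective p) {k : ℕ} {x y : Fin (k + 1) → W}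
    {w : Fin k → ι} (h : Trace p x w) (h' : Trace p y w) (h0 : x 0 = y 0) : x = y := by
  ext i
  induction i using Fin.induction with
  | zero => exact h0
  | succ i ih => exact hp (by rw [h i, h' i, ih])

theorem Trace.apply_eq {k : ℕ} {x : Fin (k + 1) → W} {w : Fin k → ι} (h : Trace p x w)
    (i : Fin (k + 1)) :
    p (x i) = p (x 0) + ∑ m : Fin k, if m.castSucc < i then Pi.single (w m) 1 else 0 := by
  induction i using Fin.induction with
  | zero => simp
  | succ i ih =>
    rw [h i, ih, add_assoc]
    congr 1
    simp_rw [ite_castSucc_lt_succ, Finset.sum_add_distrib]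
    simp

/-- Swapping two consecutive letters changes only the node between them. -/
theorem Trace.swap_apply (hp : Function.Injective p) {k : ℕ} {x y : Fin (k + 2) → W}
    {w : Fin (k + 1) → ι} {j : Fin k} (h : Trace p x w)
    (h' : Trace p y (w ∘ Equiv.swap j.castSucc j.succ)) (h0 : y 0 = x 0)
    {i : Fin (k + 2)} (hi : i ≠ j.succ.castSucc) : y i = x i := by
  apply hp
  rw [h.apply_eq, h'.apply_eq, h0]
  congr 1
  rw [← Equiv.sum_comp (Equiv.swap j.castSucc j.succ)
    (fun m => if m.castSucc < i then (Pi.single (w m) 1 : ι → ZMod 2) else 0)]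
  refine Finset.sum_congr rfl fun m _ => ?_
  -- The swapped positions are adjacent, so a prefix contains both or neither unless it ends exactly
  -- between them.
  have : (m.castSucc < i) ↔ (Equiv.swap j.castSucc j.succ m).castSucc < i := by
    have hi' : (i : ℕ) ≠ j + 1 := fun h => hi (Fin.ext (by simpa using h))
    rcases eq_or_ne m j.castSucc with rfl | h1
    · simp [Fin.lt_def]; omega
    · rcases eq_or_ne m j.succ with rfl | h2
      · simp [Fin.lt_def]; omega
      · rw [Equiv.swap_apply_of_ne_of_ne h1 h2]
  simp [this]

variable {G : SimpleGraph W}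

theorem Trace.adj (hG : ∀ u v, G.Adj u v ↔ ∃ h, p v = p u + Pi.single h 1) {k : ℕ}
    {x : Fin (k + 1) → W} {w : Fin k → ι} (h : Trace p x w) (i : Fin k) :
    G.Adj (x i.castSucc) (x i.succ) := (hG _ _).2 ⟨w i, h i⟩

/-- Equal letters backtrack, so the outer nodes coincide; distinct letters leave them differing in
two coordinates, hence neither equal nor adjacent. Only distances up to 2 matter, so no isometric
embedding in the cube is required. -/
theorem Trace.edist_add_iff (hp : Function.Injective p)
    (hG : ∀ u v, G.Adj u v ↔ ∃ h, p v = p u + Pi.single h 1) {k : ℕ}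
    {x : Fin (k + 2) → W} {w : Fin (k + 1) → ι} (h : Trace p x w) (j : Fin k) :
    G.edist (x j.castSucc.castSucc) (x j.succ.succ) =
      G.edist (x j.castSucc.castSucc) (x j.succ.castSucc) +
        G.edist (x j.succ.castSucc) (x j.succ.succ) ↔ w j.castSucc ≠ w j.succ := by
  have e1 : G.edist (x j.castSucc.castSucc) (x j.succ.castSucc) = 1 :=
    SimpleGraph.edist_eq_one_iff_adj.2 (h.adj hG j.castSucc)
  have e2 : G.edist (x j.succ.castSucc) (x j.succ.succ) = 1 :=
    SimpleGraph.edist_eq_one_iff_adj.2 (h.adj hG j.succ)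
  have hs : p (x j.succ.succ) = p (x j.castSucc.castSucc) +
      (Pi.single (w j.castSucc) 1 + Pi.single (w j.succ) 1) := by
    rw [h j.succ, ← add_assoc, ← h j.castSucc]; rfl
  rw [e1, e2]
  constructor
  · intro he hw
    rw [hw, add_self_zmod_two, add_zero] at hs
    rw [hp hs, SimpleGraph.edist_self] at he
    revert he
    decide
  · intro hw
    refine le_antisymm ?_ ?_
    · have := SimpleGraph.edist_triangle (G := G) (u := x j.castSucc.castSucc)
        (v := x j.succ.castSucc) (w := x j.succ.succ)
      rwa [e1, e2] at this
    · rw [show (1 + 1 : ℕ∞) = Order.succ 1 by rfl]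
      apply Order.succ_le_of_lt
      rw [← not_le, SimpleGraph.edist_le_one_iff_adj_or_eq]
      rintro (ha | ha)
      · obtain ⟨c, hc⟩ := (hG _ _).1 ha
        exact single_add_single_ne_single hw (add_left_cancel (hs.symm.trans hc))
      · rw [ha] at hs
        exact single_add_single_ne_zero hw (by simpa using hs)

open Classical in
theorem Trace.deleteNode_eq (hp : Function.Injective p)
    (hG : ∀ u v, G.Adj u v ↔ ∃ h, p v = p u + Pi.single h 1) {k : ℕ}
    {x : Fin (k + 2) → W} {w : Fin (k + 1) → ι} (h : Trace p x w) (j : Fin k) :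
    deleteNode G j x = if w j.castSucc ≠ w j.succ then
      Finsupp.single (fun i => x (j.succ.castSucc.succAbove i)) 1 else 0 := by
  unfold deleteNode
  by_cases hw : w j.castSucc ≠ w j.succ
  · rw [if_pos hw, if_pos ((h.edist_add_iff hp hG j).2 hw)]
  · rw [if_neg hw, if_neg (mt (h.edist_add_iff hp hG j).1 hw)]

theorem succAbove_middle_lt {k : ℕ} (j : Fin k) (i : Fin (k + 1)) (h : i ≤ j.castSucc) :
    j.succ.castSucc.succAbove i = i.castSucc :=
  Fin.succAbove_of_castSucc_lt _ _ (Nat.lt_succ_of_le h)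

theorem succAbove_middle_gt {k : ℕ} (j : Fin k) (i : Fin (k + 1)) (h : j.succ ≤ i) :
    j.succ.castSucc.succAbove i = i.succ :=
  Fin.succAbove_of_le_castSucc _ _ h

/-- The deleted position stays visible: there two consecutive nodes differ in two coordinates, while
before its own gap the other chain still moves along single edges. -/
theorem Trace.not_lt_of_delete_eq {k : ℕ} {x y : Fin (k + 2) → W}
    {w v : Fin (k + 1) → ι} (h : Trace p x w) (h' : Trace p y v) {j j' : Fin k}
    (hw : w j.castSucc ≠ w j.succ)
    (he : (fun i => x (j.succ.castSucc.succAbove i)) =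
      fun i => y (j'.succ.castSucc.succAbove i)) : ¬ j < j' := by
  intro hj
  have a1 := congr_fun he j.castSucc
  have a2 := congr_fun he j.succ
  rw [succAbove_middle_lt j _ le_rfl, succAbove_middle_lt j' _ (by simpa using hj.le)] at a1
  rw [succAbove_middle_gt j _ le_rfl, succAbove_middle_lt j' _
    (show (j : ℕ) + 1 ≤ j' from hj)] at a2
  have hs : p (x j.succ.succ) = p (x j.castSucc.castSucc) +
      (Pi.single (w j.castSucc) 1 + Pi.single (w j.succ) 1) := by
    rw [h j.succ, ← add_assoc, ← h j.castSucc]; rfl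
  have ht := h' j.castSucc
  rw [← a1, show j.castSucc.succ = j.succ.castSucc from rfl, ← a2] at ht
  exact single_add_single_ne_single hw (add_left_cancel (hs.symm.trans ht))

/-- Across the gap only the unordered pair of letters survives, so a face has at most two preimages,
exchanged by the swap. -/
theorem Trace.delete_eq {k : ℕ} {x y : Fin (k + 2) → W}
    {w v : Fin (k + 1) → ι} (h : Trace p x w) (h' : Trace p y v) {j j' : Fin k}
    (hw : w j.castSucc ≠ w j.succ) (hv : v j'.castSucc ≠ v j'.succ)
    (he : (fun i => x (j.succ.castSucc.succAbove i)) =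
      fun i => y (j'.succ.castSucc.succAbove i)) :
    j = j' ∧ x 0 = y 0 ∧ (w = v ∨ w = v ∘ Equiv.swap j'.castSucc j'.succ) := by
  obtain rfl : j = j' := le_antisymm (not_lt.1 (h'.not_lt_of_delete_eq h hv he.symm))
    (not_lt.1 (h.not_lt_of_delete_eq h' hw he))
  have hxy : ∀ i ≠ j.succ.castSucc, x i = y i := by
    intro i hi
    obtain ⟨m, rfl⟩ := Fin.exists_succAbove_eq hi
    exact congr_fun he m
  have hxy' : ∀ i : Fin (k + 1), i ≠ j.castSucc → i ≠ j.succ → w i = v i := by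
    intro i h1 h2
    have a1 := hxy i.castSucc (fun h => h2 (Fin.castSucc_injective _ h))
    have a2 := hxy i.succ (fun h => h1 (Fin.succ_injective _ h))
    have := h i
    rw [a1, a2, h' i] at this
    exact (single_one_injective (add_left_cancel this)).symm
  refine ⟨rfl, hxy 0 (by simp [Fin.ext_iff]), ?_⟩
  have hs : p (x j.succ.succ) = p (x j.castSucc.castSucc) +
      (Pi.single (w j.castSucc) 1 + Pi.single (w j.succ) 1) := by
    rw [h j.succ, ← add_assoc, ← h j.castSucc]; rfl
  have ht : p (y j.succ.succ) = p (y j.castSucc.castSucc) +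
      (Pi.single (v j.castSucc) 1 + Pi.single (v j.succ) 1) := by
    rw [h' j.succ, ← add_assoc, ← h' j.castSucc]; rfl
  rw [← hxy j.succ.succ (by simp [Fin.ext_iff]),
    ← hxy j.castSucc.castSucc (by simp [Fin.ext_iff])] at ht
  rcases single_add_single_eq hw (add_left_cancel (hs.symm.trans ht)) with ⟨e1, e2⟩ | ⟨e1, e2⟩
  · left
    ext i
    by_cases h1 : i = j.castSucc
    · rw [h1, e1]
    by_cases h2 : i = j.succ
    · rw [h2, e2]
    exact hxy' i h1 h2
  · right
    ext i
    by_cases h1 : i = j.castSucc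
    · rw [h1, e1]; simp
    by_cases h2 : i = j.succ
    · rw [h2, e2]; simp
    simp [Equiv.swap_apply_of_ne_of_ne h1 h2, hxy' i h1 h2]

theorem Trace.sum_deleteNode (hp : Function.Injective p)
    (hG : ∀ u v, G.Adj u v ↔ ∃ h, p v = p u + Pi.single h 1) {k : ℕ}
    {x y : Fin (k + 2) → W} {w v : Fin (k + 1) → ι} (h : Trace p x w) (h' : Trace p y v)
    (j : Fin k) (hv : v j.castSucc ≠ v j.succ) [Decidable (x 0 = y 0 ∧ Trace p x v)]
    [Decidable (x 0 = y 0 ∧ Trace p x (v ∘ Equiv.swap j.castSucc j.succ))] :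
    ∑ i : Fin k, (-1 : ℤ) ^ (i : ℕ) *
        deleteNode G i x (fun m => y (j.succ.castSucc.succAbove m)) =
      (-1) ^ (j : ℕ) * ((if x 0 = y 0 ∧ Trace p x v then 1 else 0) +
        if x 0 = y 0 ∧ Trace p x (v ∘ Equiv.swap j.castSucc j.succ) then 1 else 0) := by
  classical
  rw [Finset.sum_eq_single j]
  · congr 1
    have hne : v ≠ v ∘ Equiv.swap j.castSucc j.succ := fun e => hv (by
      have := congr_fun e j.castSucc
      simpa using this)
    rw [h.deleteNode_eq hp hG]
    by_cases h1 : x 0 = y 0 ∧ Trace p x v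
    · obtain rfl := h1.2.chain_unique hp h' h1.1
      have : ¬ Trace p x (v ∘ Equiv.swap j.castSucc j.succ) := fun h2 => hne (h'.word_unique h2)
      obtain rfl := h.word_unique h'
      simp [h', this, hv]
    by_cases h2 : x 0 = y 0 ∧ Trace p x (v ∘ Equiv.swap j.castSucc j.succ)
    · have hw : w j.castSucc ≠ w j.succ := by
        rw [h.word_unique h2.2]
        simpa using hv.symm
      rw [if_pos hw, if_neg h1, if_pos h2, Finsupp.single_apply, if_pos]
      · simp
      · ext m
        exact h'.swap_apply hp h2.2 h2.1 (Fin.succAbove_ne _ _)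
    · rw [if_neg h1, if_neg h2]
      split_ifs with hw
      · rw [Finsupp.single_apply, if_neg]
        · simp
        · intro he
          obtain ⟨-, h0, rfl | rfl⟩ := h.delete_eq h' hw hv he
          · exact h1 ⟨h0, h⟩
          · exact h2 ⟨h0, h⟩
      · simp
  · intro i _ hi
    rw [h.deleteNode_eq hp hG]
    split_ifs with hw
    · rw [Finsupp.single_apply, if_neg, mul_zero]
      intro he
      exact hi (h.delete_eq h' hw hv he).1
    · simp
  · simp

variable [Fintype W]

open Classical in
variable (p) in
/-- The coefficient of a chain group element at the chain with first node `u` and word `w`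
(`0` if there is no such chain). -/
noncomputable def wordCoeff {k : ℕ} (c : (Fin (k + 1) → W) →₀ ℤ) (u : W) (w : Fin k → ι) : ℤ :=
  ∑ x : Fin (k + 1) → W, if x 0 = u ∧ Trace p x w then c x else 0

theorem wordCoeff_eq (hp : Function.Injective p) {k : ℕ} (c : (Fin (k + 1) → W) →₀ ℤ)
    {x : Fin (k + 1) → W} {w : Fin k → ι} (h : Trace p x w) :
    wordCoeff p c (x 0) w = c x := by
  classical
  unfold wordCoeff
  rw [Finset.sum_eq_single x]
  · simp [h]
  · intro y _ hy
    rw [if_neg]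
    rintro ⟨h1, h2⟩
    exact hy (h2.chain_unique hp h h1)
  · simp

theorem wordCoeff_eq_zero {k : ℕ} (c : (Fin (k + 1) → W) →₀ ℤ) {u : W} {w : Fin k → ι}
    (h : ¬ ∃ x : Fin (k + 1) → W, x 0 = u ∧ Trace p x w) : wordCoeff p c u w = 0 := by
  classical
  exact Finset.sum_eq_zero fun x _ => if_neg fun hx => h ⟨x, hx⟩

theorem wordCoeff_add {k : ℕ} (c d : (Fin (k + 1) → W) →₀ ℤ) (u : W) (w : Fin k → ι) :
    wordCoeff p (c + d) u w = wordCoeff p c u w + wordCoeff p d u w := by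
  classical
  unfold wordCoeff
  rw [← Finset.sum_add_distrib]
  exact Finset.sum_congr rfl fun x _ => by split_ifs <;> simp

theorem wordCoeff_smul {k : ℕ} (a : ℤ) (c : (Fin (k + 1) → W) →₀ ℤ) (u : W) (w : Fin k → ι) :
    wordCoeff p (a • c) u w = a * wordCoeff p c u w := by
  classical
  unfold wordCoeff
  rw [Finset.mul_sum]
  exact Finset.sum_congr rfl fun x _ => by split_ifs <;> simp

theorem boundary_apply {k : ℕ} (c : (Fin (k + 2) → W) →₀ ℤ) (y : Fin (k + 1) → W) :
    boundary G k c y = ∑ x, c x * ∑ j : Fin k, (-1 : ℤ) ^ (j : ℕ) * deleteNode G j x y := by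
  classical
  unfold boundary
  rw [Finsupp.linearCombination_apply, Finsupp.sum_fintype _ _ (by simp)]
  simp [Finsupp.finsetSum_apply]

theorem Trace.boundary_apply_delete (hp : Function.Injective p)
    (hG : ∀ u v, G.Adj u v ↔ ∃ h, p v = p u + Pi.single h 1) {k : ℕ}
    {c : (Fin (k + 2) → W) →₀ ℤ} (hc : ∀ x, c x ≠ 0 → ∃ w, Trace p x w)
    {y : Fin (k + 2) → W} {v : Fin (k + 1) → ι} (h' : Trace p y v)
    (j : Fin k) (hv : v j.castSucc ≠ v j.succ) :
    boundary G k c (fun m => y (j.succ.castSucc.succAbove m)) =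
      (-1) ^ (j : ℕ) * (wordCoeff p c (y 0) v +
        wordCoeff p c (y 0) (v ∘ Equiv.swap j.castSucc j.succ)) := by
  classical
  rw [boundary_apply]
  unfold wordCoeff
  rw [← Finset.sum_add_distrib, Finset.mul_sum]
  refine Finset.sum_congr rfl fun x _ => ?_
  by_cases hx : c x = 0
  · simp [hx]
  obtain ⟨w, hw⟩ := hc x hx
  rw [hw.sum_deleteNode hp hG h' j hv]
  split_ifs <;> ring

/-- Every face coefficient is, up to sign, the sum of the coefficients at a word and at its swap.
Words without a walk count as 0, so the condition also kills a coefficient whose swapped word is not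
a walk. -/
theorem boundary_eq_zero_iff (hp : Function.Injective p)
    (hG : ∀ u v, G.Adj u v ↔ ∃ h, p v = p u + Pi.single h 1) {k : ℕ}
    {c : (Fin (k + 2) → W) →₀ ℤ} (hc : ∀ x, c x ≠ 0 → ∃ w, Trace p x w) :
    boundary G k c = 0 ↔ ∀ u (w : Fin (k + 1) → ι) (j : Fin k), w j.castSucc ≠ w j.succ →
      wordCoeff p c u (w ∘ Equiv.swap j.castSucc j.succ) = - wordCoeff p c u w := by
  classical
  constructor
  · intro h0 u w j hj
    have key : ∀ w : Fin (k + 1) → ι, w j.castSucc ≠ w j.succ →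
        (∃ y : Fin (k + 2) → W, y 0 = u ∧ Trace p y w) →
        wordCoeff p c u (w ∘ Equiv.swap j.castSucc j.succ) = - wordCoeff p c u w := by
      rintro w hj ⟨y, rfl, hy⟩
      have := hy.boundary_apply_delete hp hG hc j hj
      rw [h0] at this
      have := (mul_eq_zero.1 this.symm).resolve_left (by simp)
      linarith
    by_cases h1 : ∃ y : Fin (k + 2) → W, y 0 = u ∧ Trace p y w
    · exact key w hj h1
    by_cases h2 : ∃ y : Fin (k + 2) → W, y 0 = u ∧ Trace p y (w ∘ Equiv.swap j.castSucc j.succ)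
    · have := key _ (by simpa using hj.symm) h2
      rw [Function.comp_assoc, ← Equiv.coe_trans, Equiv.swap_swap, Equiv.coe_refl,
        Function.comp_id] at this
      rw [this, neg_neg]
    · rw [wordCoeff_eq_zero c h1, wordCoeff_eq_zero c h2, neg_zero]
  · intro hanti
    ext y
    by_cases hy : ∃ x w, ∃ j : Fin k, Trace p x w ∧ w j.castSucc ≠ w j.succ ∧
      (fun m => x (j.succ.castSucc.succAbove m)) = y
    · obtain ⟨x, w, j, hx, hj, rfl⟩ := hy
      rw [hx.boundary_apply_delete hp hG hc j hj, hanti _ _ _ hj]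
      simp
    · rw [boundary_apply]
      refine Finset.sum_eq_zero fun x _ => ?_
      by_cases hx : c x = 0
      · simp [hx]
      obtain ⟨w, hw⟩ := hc x hx
      rw [Finset.sum_eq_zero, mul_zero]
      intro j _
      rw [hw.deleteNode_eq hp hG]
      split_ifs with hj
      · rw [Finsupp.single_apply, if_neg, mul_zero]
        exact fun he => hy ⟨x, w, j, hw, hj, he⟩
      · simp

end Hypercube

end MagnitudeHomology

/-! ### Sorting signs and multisets of letters. -/

namespace MagnitudeHomology

section Words

variable {ι : Type*} {n ℓ : ℕ}

section Sign

variable (e : ι ≃ Fin n)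

/-- The sign of the permutation that sorts the word `w`. -/
def wordSign (w : Fin ℓ → ι) : ℤ := Equiv.Perm.sign (Tuple.sort (e ∘ w))

theorem wordSign_mul_self (w : Fin ℓ → ι) : wordSign e w * wordSign e w = 1 := by
  unfold wordSign
  rw [← Units.val_mul, Int.units_mul_self, Units.val_one]

/-- `Tuple.sort` breaks ties by position. Swapping adjacent distinct letters keeps equal letters in
order, so the new sorting permutation is the old one composed with the transposition. -/
theorem wordSign_swap {k : ℕ} (w : Fin (k + 1) → ι) (j : Fin k) (hj : w j.castSucc ≠ w j.succ) :
    wordSign e (w ∘ Equiv.swap j.castSucc j.succ) = - wordSign e w := by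
  have key : Equiv.swap j.castSucc j.succ * Tuple.sort (e ∘ w) =
      Tuple.sort (e ∘ (w ∘ Equiv.swap j.castSucc j.succ)) := by
    obtain ⟨h1, h2⟩ := (Tuple.eq_sort_iff (f := e ∘ w)).1 rfl
    rw [Tuple.eq_sort_iff]
    have hinv : ∀ i, (e ∘ (w ∘ Equiv.swap j.castSucc j.succ))
        ((Equiv.swap j.castSucc j.succ * Tuple.sort (e ∘ w)) i) =
        (e ∘ w) (Tuple.sort (e ∘ w) i) := fun i => by simp
    refine ⟨fun a b hab => ?_, fun a b hab he => ?_⟩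
    · have := h1 hab
      simpa using this
    · rw [hinv, hinv] at he
      have h3 := h2 a b hab he
      set s := Tuple.sort (e ∘ w) a
      set t := Tuple.sort (e ∘ w) b
      change Equiv.swap j.castSucc j.succ s < Equiv.swap j.castSucc j.succ t
      have h4 : w s = w t := e.injective he
      have h3' : (s : ℕ) < t := h3
      rcases eq_or_ne s j.castSucc with hs | hs1
      · have ht : t ≠ j.succ := fun ht => hj (by rw [← hs, ← ht, h4])
        have ht2 : t ≠ j.castSucc := fun ht => h3.ne (hs.trans ht.symm)
        have ht' : (t : ℕ) ≠ j + 1 := fun h => ht (Fin.ext (by simpa using h))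
        have hs' : (s : ℕ) = j := by rw [hs]; rfl
        rw [Equiv.swap_apply_of_ne_of_ne ht2 ht, hs, Equiv.swap_apply_left]
        change (j : ℕ) + 1 < t
        omega
      rcases eq_or_ne s j.succ with hs | hs2
      · have ht : t ≠ j.castSucc := fun ht => hj (by rw [← hs, ← ht, h4])
        have ht2 : t ≠ j.succ := fun ht => h3.ne (hs.trans ht.symm)
        have hs' : (s : ℕ) = j + 1 := by rw [hs]; rfl
        rw [Equiv.swap_apply_of_ne_of_ne ht ht2, hs, Equiv.swap_apply_right]
        change (j : ℕ) < t
        omega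
      rw [Equiv.swap_apply_of_ne_of_ne hs1 hs2]
      have hs1' : (s : ℕ) ≠ j := fun h => hs1 (Fin.ext (by simpa using h))
      have hs2' : (s : ℕ) ≠ j + 1 := fun h => hs2 (Fin.ext (by simpa using h))
      rcases eq_or_ne t j.castSucc with ht | ht1
      · have ht' : (t : ℕ) = j := by rw [ht]; rfl
        rw [ht, Equiv.swap_apply_left]
        change (s : ℕ) < j + 1
        omega
      rcases eq_or_ne t j.succ with ht | ht2
      · have ht' : (t : ℕ) = j + 1 := by rw [ht]; rfl
        rw [ht, Equiv.swap_apply_right]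
        change (s : ℕ) < j
        omega
      rw [Equiv.swap_apply_of_ne_of_ne ht1 ht2]
      exact h3
  unfold wordSign
  rw [← key, Equiv.Perm.sign_mul, Equiv.Perm.sign_swap]
  · simp
  · simp [Fin.ext_iff]

end Sign

/-- The multiset of letters of a word. -/
def wordSym (w : Fin ℓ → ι) : Sym ι ℓ := ⟨Finset.univ.val.map w, by simp⟩

/-- Equal multisets give fibres of equal size over each letter; bijections of the fibres glue to a
permutation of positions. -/
theorem wordSym_eq_iff (w v : Fin ℓ → ι) : wordSym w = wordSym v ↔
    ∃ σ : Equiv.Perm (Fin ℓ), w = v ∘ σ := by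
  constructor
  · intro h
    have hm : Finset.univ.val.map w = Finset.univ.val.map v := congr_arg Subtype.val h
    classical
    have hc : ∀ a, Nonempty ({i // w i = a} ≃ {i // v i = a}) := fun a => by
      have := congr_arg (Multiset.count a) hm
      rw [Multiset.count_map, Multiset.count_map] at this
      refine ⟨Fintype.equivOfCardEq ?_⟩
      rw [Fintype.card_subtype, Fintype.card_subtype]
      simpa [Finset.card, Finset.filter_val, eq_comm] using this
    refine ⟨Equiv.ofFiberEquiv fun a => (hc a).some, funext fun i => ?_⟩
    exact (Equiv.ofFiberEquiv_map _ i).symm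
  · rintro ⟨σ, rfl⟩
    refine Subtype.ext ?_
    change Finset.univ.val.map (v ∘ σ) = Finset.univ.val.map v
    rw [← Multiset.map_map, Multiset.map_univ_val_equiv]

theorem wordSym_surjective : Function.Surjective (wordSym : (Fin ℓ → ι) → Sym ι ℓ) := by
  rintro ⟨m, hm⟩
  obtain ⟨l, rfl⟩ := Quot.exists_rep m
  have hl : l.length = ℓ := hm
  subst hl
  refine ⟨l.get, Subtype.ext ?_⟩
  change Multiset.map l.get ((List.finRange l.length : List _) : Multiset _) = _
  rw [Multiset.map_coe]
  simp

end Words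

/-! ### Cycles as permutation-invariant functions after the sign twist. -/

section Cycles

variable {W ι : Type*} [Fintype W] [DecidableEq ι] {p : W → ι → ZMod 2} {G : SimpleGraph W}
  {P : ∀ k : ℕ, Set (Fin (k + 1) → W)} {n ℓ : ℕ} (e : ι ≃ Fin n)

/-- The sign cancels the antisymmetry, swaps of equal letters do nothing, and adjacent
transpositions generate the symmetric group. In degree 0 both conditions are vacuous. -/
theorem mem_cycles_iff (hp : Function.Injective p)
    (hG : ∀ u v, G.Adj u v ↔ ∃ h, p v = p u + Pi.single h 1)
    (hP : ∀ x ∈ P ℓ, ∃ w, Trace p x w) (c : (Fin (ℓ + 1) → W) →₀ ℤ) :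
    c ∈ cycles G P ℓ ↔ c ∈ chains P ℓ ∧ ∀ u (w : Fin ℓ → ι) (σ : Equiv.Perm (Fin ℓ)),
      wordSign e (w ∘ σ) * wordCoeff p c u (w ∘ σ) = wordSign e w * wordCoeff p c u w := by
  match ℓ with
  | 0 =>
    refine ⟨fun h => ⟨h, fun u w σ => ?_⟩, fun h => h.1⟩
    rw [Subsingleton.elim (w ∘ σ) w]
  | k + 1 =>
    change c ∈ chains P (k + 1) ⊓ LinearMap.ker (boundary G k) ↔ _
    rw [Submodule.mem_inf]
    refine and_congr_right fun hc => ?_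
    have hc' : ∀ x, c x ≠ 0 → ∃ w, Trace p x w := fun x hx =>
      hP x (hc (by simpa using hx))
    rw [LinearMap.mem_ker, boundary_eq_zero_iff hp hG hc']
    constructor
    · intro h u w σ
      have hσ : σ ∈ Submonoid.closure
          (Set.range fun i : Fin k ↦ Equiv.swap i.castSucc i.succ) := by
        rw [Equiv.Perm.mclosure_swap_castSucc_succ]; trivial
      induction hσ using Submonoid.closure_induction_right with
      | one => rfl
      | mul_right σ _ τ hτ ih =>
        obtain ⟨j, rfl⟩ := hτ
        rw [← ih]
        rw [Equiv.Perm.coe_mul, ← Function.comp_assoc]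
        by_cases hj : (w ∘ σ) j.castSucc = (w ∘ σ) j.succ
        · have : (w ∘ σ) ∘ Equiv.swap j.castSucc j.succ = w ∘ σ := by
            ext i
            rcases eq_or_ne i j.castSucc with rfl | h1
            · simpa using hj.symm
            rcases eq_or_ne i j.succ with rfl | h2
            · simpa using hj
            simp [Equiv.swap_apply_of_ne_of_ne h1 h2]
          rw [this]
        · rw [h u _ j hj, wordSign_swap e _ j hj]
          ring
    · intro h u w j hj
      have := h u w (Equiv.swap j.castSucc j.succ)
      rw [wordSign_swap e _ j hj] at this
      have h2 := congr_arg (fun z => wordSign e w * z) this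
      simp only [← mul_assoc, mul_neg, neg_mul, wordSign_mul_self, one_mul] at h2
      linarith

end Cycles

/-! ### Cubes, a basis of the cycles, and its cardinality. -/

section Count

variable {W ι : Type*} [DecidableEq ι] {p : W → ι → ZMod 2} {G : SimpleGraph W}
  {P : ∀ k : ℕ, Set (Fin (k + 1) → W)} {ℓ : ℕ}

variable (p) in
/-- All nodes obtained from `u` by changing coordinates in `B` exist. -/
def CubeAt (u : W) (B : Finset ι) : Prop :=
  ∀ S ⊆ B, ∃ v, p v = p u + fun h => if h ∈ S then 1 else 0

theorem exists_trace_of_forall {u : W} {w : Fin ℓ → ι}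
    (h : ∀ i : Fin (ℓ + 1), ∃ v, p v = p u +
      ∑ m : Fin ℓ, if m.castSucc < i then Pi.single (w m) 1 else 0)
    (hp : Function.Injective p) :
    ∃ x : Fin (ℓ + 1) → W, x 0 = u ∧ Trace p x w := by
  choose x hx using h
  refine ⟨x, hp (by simpa using hx 0), fun i => ?_⟩
  rw [hx, hx, add_assoc]
  congr 1
  simp_rw [ite_castSucc_lt_succ, Finset.sum_add_distrib]
  simp

theorem CubeAt.exists_trace (hp : Function.Injective p) {u : W} {w : Fin ℓ → ι}
    (h : CubeAt p u (Finset.univ.image w)) :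
    ∃ x : Fin (ℓ + 1) → W, x 0 = u ∧ Trace p x w := by
  refine exists_trace_of_forall (fun i => ?_) hp
  set z : ι → ZMod 2 := ∑ m : Fin ℓ, if m.castSucc < i then Pi.single (w m) 1 else 0 with hz
  -- The relevant vertex of the cube is given by the letters occurring an odd number of times in the
  -- prefix.
  obtain ⟨v, hv⟩ := h ((Finset.univ.image w).filter fun a => z a = 1) (Finset.filter_subset _ _)
  refine ⟨v, ?_⟩
  rw [hv]
  congr 1
  ext a
  have h01 : ∀ t : ZMod 2, t = 0 ∨ t = 1 := by decide
  by_cases ha : a ∈ Finset.univ.image w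
  · rcases h01 (z a) with h | h <;> simp [h, ha]
  · have : z a = 0 := by
      rw [hz, Finset.sum_apply]
      refine Finset.sum_eq_zero fun m _ => ?_
      have : a ≠ w m := fun h => ha (by simp [h])
      split_ifs <;> simp [this]
    simp [this]

/-- To reach the vertex of S, rearrange the word so that one occurrence of each letter of S comes
first, and stop after |S| steps. -/
theorem cubeAt_of_forall_exists_trace {u : W} {w : Fin ℓ → ι}
    (h : ∀ σ : Equiv.Perm (Fin ℓ), ∃ x : Fin (ℓ + 1) → W, x 0 = u ∧ Trace p x (w ∘ σ)) :
    CubeAt p u (Finset.univ.image w) := by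
  intro S hS
  have hr : ∀ s : S, ∃ i, w i = s := fun s => by
    have := hS s.2
    simpa using this
  choose r hr using hr
  have hrinj : Function.Injective r := fun s t hst => Subtype.ext (by rw [← hr, ← hr, hst])
  have hcard : S.card ≤ ℓ := by simpa using Fintype.card_le_of_injective r hrinj
  have e1 : {i : Fin ℓ // (i : ℕ) < S.card} ≃ Fin S.card :=
    ⟨fun i => ⟨i.1, i.2⟩, fun i => ⟨⟨i, i.2.trans_le hcard⟩, i.2⟩, fun _ => rfl, fun _ => rfl⟩
  have e2 : {i : Fin ℓ // (i : ℕ) < S.card} ≃ {i // i ∈ Set.range r} :=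
    e1.trans (S.equivFin.symm.trans (Equiv.ofInjective r hrinj))
  obtain ⟨x, hx0, hx⟩ := h (e2.extendSubtype)
  refine ⟨x ⟨S.card, by omega⟩, ?_⟩
  rw [hx.apply_eq, hx0]
  congr 1
  have hiff : ∀ m : Fin ℓ, m.castSucc < (⟨S.card, by omega⟩ : Fin (ℓ + 1)) ↔
      e2.extendSubtype m ∈ Set.range r := by
    intro m
    by_cases hm : (m : ℕ) < S.card
    · exact ⟨fun _ => e2.extendSubtype_mem m hm, fun _ => hm⟩
    · exact ⟨fun h => absurd h hm, fun h => absurd h (e2.extendSubtype_not_mem m hm)⟩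
  classical
  have : ∀ m : Fin ℓ, (if m.castSucc < (⟨S.card, by omega⟩ : Fin (ℓ + 1)) then
      (Pi.single ((w ∘ e2.extendSubtype) m) 1 : ι → ZMod 2) else 0) =
      (fun i => if i ∈ Set.range r then (Pi.single (w i) 1 : ι → ZMod 2) else 0)
        (e2.extendSubtype m) := fun m => by simp only [hiff, Function.comp]
  rw [Finset.sum_congr rfl fun m _ => this m, Equiv.sum_comp e2.extendSubtype
    (fun i => if i ∈ Set.range r then (Pi.single (w i) 1 : ι → ZMod 2) else 0),
    ← Finset.sum_filter]
  have himg : (Finset.univ.filter fun i => i ∈ Set.range r) = Finset.univ.image r := by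
    ext; simp
  rw [himg, Finset.sum_image (fun a _ b _ h => hrinj h)]
  simp only [hr]
  ext a
  rw [Finset.sum_apply, Finset.sum_coe_sort S (fun s => (Pi.single s 1 : ι → ZMod 2) a)]
  simp [Pi.single_apply]

variable (p) in
/-- The index set of a basis of the diagonal homology. -/
abbrev DiagIndex (Q : Finset ι → Prop) (ℓ : ℕ) : Type _ :=
  {um : W × Sym ι ℓ // Q (um.2 : Multiset ι).toFinset ∧
    CubeAt p um.1 (um.2 : Multiset ι).toFinset}

/-- A cycle nonzero at one word is nonzero at all its rearrangements, which are therefore all walks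
and span a cube. Conversely, any function on cube pairs, extended by zero and twisted by the sign,
is a cycle. -/
theorem exists_cycles_equiv [Fintype W] [Finite ι] (hp : Function.Injective p)
    (hG : ∀ u v, G.Adj u v ↔ ∃ h, p v = p u + Pi.single h 1) {Q : Finset ι → Prop}
    (hP : ∀ x, x ∈ P ℓ ↔ ∃ w, Trace p x w ∧ Q (Finset.univ.image w)) :
    Nonempty (cycles G P ℓ ≃ₗ[ℤ] (DiagIndex p Q ℓ → ℤ)) := by
  classical
  obtain ⟨n, ⟨e⟩⟩ := Finite.exists_equiv_fin ι
  have hP' : ∀ x ∈ P ℓ, ∃ w, Trace p x w := fun x hx =>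
    ((hP x).1 hx).imp fun _ h => h.1
  have hrep := fun m : Sym ι ℓ => wordSym_surjective m
  choose rep hrep using hrep
  let Φ : cycles G P ℓ →ₗ[ℤ] (DiagIndex p Q ℓ → ℤ) :=
    { toFun := fun c i => wordSign e (rep i.1.2) * wordCoeff p c.1 i.1.1 (rep i.1.2)
      map_add' := fun c d => by
        ext i
        simp [wordCoeff_add, mul_add]
      map_smul' := fun a c => by
        ext i
        simp only [Submodule.coe_smul, wordCoeff_smul, Pi.smul_apply, smul_eq_mul,
          RingHom.id_apply]
        ring }
  refine ⟨LinearEquiv.ofBijective Φ ⟨?_, ?_⟩⟩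
  · rw [← LinearMap.ker_eq_bot, LinearMap.ker_eq_bot']
    rintro ⟨c, hc⟩ h0
    obtain ⟨hc1, hc2⟩ := (mem_cycles_iff e hp hG hP' c).1 hc
    ext x
    change c x = 0
    by_contra hx
    obtain ⟨w, hw, hQ⟩ := (hP x).1 (hc1 (by simpa using hx))
    rw [← wordCoeff_eq hp c hw] at hx
    have hne : ∀ σ : Equiv.Perm (Fin ℓ), wordCoeff p c (x 0) (w ∘ σ) ≠ 0 := by
      intro σ h
      have := hc2 (x 0) w σ
      rw [h, mul_zero] at this
      rcases mul_eq_zero.1 this.symm with h | h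
      · have := wordSign_mul_self e w
        rw [h] at this
        simp at this
      · exact hx h
    have hcube : CubeAt p (x 0) (Finset.univ.image w) := by
      refine cubeAt_of_forall_exists_trace fun σ => ?_
      by_contra h
      exact hne σ (wordCoeff_eq_zero c h)
    have := congr_fun h0 ⟨(x 0, wordSym w), hQ, hcube⟩
    obtain ⟨σ, hσ⟩ := (wordSym_eq_iff _ _).1 (hrep (wordSym w))
    change wordSign e (rep (wordSym w)) * wordCoeff p c (x 0) (rep (wordSym w)) = 0 at this
    rcases mul_eq_zero.1 this with h | h
    · have := wordSign_mul_self e (rep (wordSym w))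
      rw [h] at this
      simp at this
    · rw [hσ] at h
      exact hne σ h
  · intro d
    let D : W → Sym ι ℓ → ℤ := fun u m =>
      if h : Q (m : Multiset ι).toFinset ∧ CubeAt p u (m : Multiset ι).toFinset then
        d ⟨(u, m), h⟩ else 0
    let c : (Fin (ℓ + 1) → W) →₀ ℤ := Finsupp.equivFunOnFinite.symm fun x =>
      if h : ∃ w, Trace p x w then wordSign e h.choose * D (x 0) (wordSym h.choose) else 0
    have hcx : ∀ x w, Trace p x w → c x = wordSign e w * D (x 0) (wordSym w) := by
      intro x w hw
      have h : ∃ w, Trace p x w := ⟨w, hw⟩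
      have : h.choose = w := h.choose_spec.word_unique hw
      simp only [c, Finsupp.equivFunOnFinite_symm_apply_apply, dif_pos h, this]
    have hcw : ∀ u w, wordCoeff p c u w = wordSign e w * D u (wordSym w) := by
      intro u w
      by_cases h : ∃ x : Fin (ℓ + 1) → W, x 0 = u ∧ Trace p x w
      · obtain ⟨x, rfl, hw⟩ := h
        rw [wordCoeff_eq hp c hw, hcx x w hw]
      · rw [wordCoeff_eq_zero c h]
        have : D u (wordSym w) = 0 := dif_neg fun h' => h (h'.2.exists_trace hp)
        rw [this, mul_zero]
    have hc : c ∈ cycles G P ℓ := by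
      rw [mem_cycles_iff e hp hG hP']
      refine ⟨fun x hx => ?_, fun u w σ => ?_⟩
      · have hx : c x ≠ 0 := by simpa using hx
        have h : ∃ w, Trace p x w := by
          by_contra h
          exact hx (by simp only [c, Finsupp.equivFunOnFinite_symm_apply_apply, dif_neg h])
        obtain ⟨w, hw⟩ := h
        refine (hP x).2 ⟨w, hw, ?_⟩
        rw [hcx x w hw] at hx
        by_contra hQ
        exact hx (by rw [show D (x 0) (wordSym w) = 0 from dif_neg fun h => hQ h.1, mul_zero])
      · rw [hcw, hcw, ← mul_assoc, ← mul_assoc, wordSign_mul_self, wordSign_mul_self,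
          (wordSym_eq_iff (w ∘ σ) w).2 ⟨σ, rfl⟩]
    refine ⟨⟨c, hc⟩, funext fun i => ?_⟩
    change wordSign e (rep i.1.2) * wordCoeff p c i.1.1 (rep i.1.2) = d i
    rw [hcw, ← mul_assoc, wordSign_mul_self, one_mul, hrep]
    exact dif_pos i.2

/-- The diagonal homology of an induced subgraph of a hypercube is free of finite rank. -/
theorem diagonal_homology [Fintype W] [Finite ι] (hp : Function.Injective p)
    (hG : ∀ u v, G.Adj u v ↔ ∃ h, p v = p u + Pi.single h 1) {Q : Finset ι → Prop}
    (hP : ∀ x, x ∈ P ℓ ↔ ∃ w, Trace p x w ∧ Q (Finset.univ.image w))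
    (hP' : P (ℓ + 1) = ∅) :
    Module.Free ℤ (Homology G P ℓ) ∧ Module.Finite ℤ (Homology G P ℓ) ∧
      Module.finrank ℤ (Homology G P ℓ) = Nat.card (DiagIndex p Q ℓ) := by
  obtain ⟨E⟩ := exists_cycles_equiv hp hG hP
  have hb : (boundaries G P ℓ).submoduleOf (cycles G P ℓ) = ⊥ := by
    unfold boundaries chains
    rw [hP', Finsupp.supported_empty, Submodule.map_bot, Submodule.submoduleOf,
      Submodule.comap_bot, Submodule.ker_subtype]
  have E' : Homology G P ℓ ≃ₗ[ℤ] (DiagIndex p Q ℓ → ℤ) :=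
    (Submodule.quotEquivOfEqBot _ hb).trans E
  have : Finite (Sym ι ℓ) := by
    classical
    have := Fintype.ofFinite ι
    infer_instance
  have := Fintype.ofFinite (DiagIndex p Q ℓ)
  refine ⟨Module.Free.of_equiv E'.symm, Module.Finite.equiv E'.symm, ?_⟩
  rw [E'.finrank_eq, Module.finrank_fintype_fun_eq_card, Nat.card_eq_fintype_card]

/-- The number of multisets of size `ℓ` with a given support of size `r`. -/
def surjCount (ℓ r : ℕ) : ℕ := if r ≤ ℓ then r.multichoose (ℓ - r) else 0

/-- Removing one copy of each element of B leaves an arbitrary multiset of size ℓ - |B| on B. -/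
theorem card_sym_toFinset [Finite ι] (B : Finset ι) :
    Nat.card {m : Sym ι ℓ // (m : Multiset ι).toFinset = B} = surjCount ℓ B.card := by
  unfold surjCount
  split_ifs with h
  · let f : Sym B (ℓ - B.card) → {m : Sym ι ℓ // (m : Multiset ι).toFinset = B} := fun n =>
      ⟨⟨(n : Multiset B).map Subtype.val + B.val, by
        rw [Multiset.card_add, Multiset.card_map,
          show Multiset.card (n : Multiset B) = ℓ - B.card from n.2, Finset.card_val]; omega⟩, by
        ext a
        simp only [Sym.coe_mk, Multiset.mem_toFinset, Multiset.mem_add, Multiset.mem_map,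
          Finset.mem_val]
        constructor
        · rintro (⟨b, -, rfl⟩ | h)
          · exact b.2
          · exact h
        · exact Or.inr⟩
    have hf : Function.Bijective f := by
      constructor
      · intro n n' h
        have h1 : (n : Multiset B).map Subtype.val + B.val =
            (n' : Multiset B).map Subtype.val + B.val := congr_arg (fun z => z.1.1) h
        exact Subtype.ext (Multiset.map_injective Subtype.val_injective (add_right_cancel h1))
      · rintro ⟨m, hm⟩
        have hle : B.val ≤ (m : Multiset ι) := by
          rw [← hm, Multiset.toFinset_val]
          exact Multiset.dedup_le _
        have hmem : ∀ a ∈ (m : Multiset ι) - B.val, a ∈ B := fun a ha => by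
          rw [← hm, Multiset.mem_toFinset]
          exact Multiset.mem_of_le (Multiset.sub_le_self _ _) ha
        refine ⟨⟨((m : Multiset ι) - B.val).pmap Subtype.mk hmem, ?_⟩, ?_⟩
        · rw [Multiset.card_pmap, Multiset.card_sub hle, Finset.card_val]
          congr 1
          exact m.2
        · refine Subtype.ext (Subtype.ext ?_)
          change (((m : Multiset ι) - B.val).pmap Subtype.mk hmem).map Subtype.val + B.val = m.1
          rw [Multiset.map_pmap, Multiset.pmap_eq_map, Multiset.map_id']
          exact Multiset.sub_add_cancel hle
    rw [← Nat.card_congr (Equiv.ofBijective f hf), Nat.card_eq_fintype_card,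
      Sym.card_sym_eq_multichoose, Fintype.card_coe]
  · rw [Nat.card_eq_zero]
    left
    refine ⟨fun m => h ?_⟩
    rw [← m.2]
    exact (Multiset.toFinset_card_le _).trans_eq m.1.2

/-- This fails for ℓ = r = 0, where the empty multiset counts once but the binomial is 0; hence the
rank formula starts at ℓ = 1. -/
theorem surjCount_eq_binom (hℓ : 1 ≤ ℓ) (r : ℕ) :
    surjCount ℓ r = binom (ℓ - 1) ((r : ℤ) - 1) := by
  unfold surjCount binom
  rcases r with _ | r
  · obtain ⟨k, rfl⟩ := Nat.exists_eq_add_of_le' hℓ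
    simp
  · have h1 : ((r + 1 : ℕ) : ℤ) - 1 = (r : ℤ) := by push_cast; ring
    rw [h1, if_neg (show ¬ (r : ℤ) < 0 by omega), Int.toNat_natCast]
    split_ifs with h
    · rw [Nat.multichoose_eq, show r + 1 + (ℓ - (r + 1)) - 1 = ℓ - 1 by omega,
        ← Nat.choose_symm (by omega)]
      congr 1
      omega
    · rw [Nat.choose_eq_zero_of_lt (by omega)]

theorem card_diagIndex [Fintype W] [Fintype ι] (Q : Finset ι → Prop) [DecidablePred Q] :
    Nat.card (DiagIndex p Q ℓ) = ∑ B : Finset ι with Q B,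
      Nat.card {u : W // CubeAt p u B} * surjCount ℓ B.card := by
  classical
  have E : DiagIndex p Q ℓ ≃ Σ B : {B : Finset ι // Q B}, {u : W // CubeAt p u B} ×
      {m : Sym ι ℓ // (m : Multiset ι).toFinset = B} :=
    { toFun := fun i => ⟨⟨(i.1.2 : Multiset ι).toFinset, i.2.1⟩, ⟨i.1.1, i.2.2⟩, ⟨i.1.2, rfl⟩⟩
      invFun := fun i => ⟨(i.2.1.1, i.2.2.1), by
        rw [i.2.2.2]; exact ⟨i.1.2, i.2.1.2⟩⟩
      left_inv := fun i => rfl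
      right_inv := by
        rintro ⟨⟨B, hB⟩, ⟨u, hu⟩, ⟨m, hm⟩⟩
        simp only at hm
        subst hm
        rfl }
  rw [Nat.card_congr E, Nat.card_sigma]
  simp_rw [Nat.card_prod, card_sym_toFinset]
  exact (Finset.sum_subtype _ (by simp)
    (fun B : Finset ι => Nat.card {u : W // CubeAt p u B} * surjCount ℓ B.card)).symm

end Count

end MagnitudeHomology

/-! ### Diagonal chains are walks along edges. -/

namespace MagnitudeHomology

/-- Each of the ℓ steps has length at least 1 and the total is ℓ, so each has length exactly 1. -/
theorem mem_properChains_diagonal {W : Type*} {G : SimpleGraph W} {ℓ : ℕ}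
    {x : Fin (ℓ + 1) → W} :
    x ∈ properChains G ℓ ℓ ↔ ∀ i : Fin ℓ, G.Adj (x i.castSucc) (x i.succ) := by
  constructor
  · rintro ⟨hx, hl⟩ i
    unfold length at hl
    have hfin : ∀ j : Fin ℓ, G.edist (x j.castSucc) (x j.succ) ≠ ⊤ := fun j h => by
      have := Finset.single_le_sum (f := fun i : Fin ℓ => G.edist (x i.castSucc) (x i.succ))
        (fun _ _ => zero_le) (Finset.mem_univ j)
      rw [hl, h] at this
      exact ENat.natCast_ne_top ℓ (top_le_iff.1 this)
    choose d hd using fun j => ENat.ne_top_iff_exists.1 (hfin j)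
    have h1 : ∀ j, 1 ≤ d j := fun j => by
      rw [Nat.one_le_iff_ne_zero]
      intro h
      have := hd j
      rw [h, Nat.cast_zero, eq_comm, SimpleGraph.edist_eq_zero_iff] at this
      exact hx j this
    have h2 : ∑ j : Fin ℓ, d j = ∑ j : Fin ℓ, 1 := by
      simp_rw [← hd] at hl
      rw [← Nat.cast_sum, ENat.natCast_inj] at hl
      simpa using hl
    have h3 := (Finset.sum_eq_sum_iff_of_le (fun j _ => h1 j)).1 h2.symm i (Finset.mem_univ i)
    rw [← SimpleGraph.edist_eq_one_iff_adj, ← hd i, ← h3, Nat.cast_one]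
  · intro h
    refine ⟨fun i => (h i).ne, ?_⟩
    unfold length
    simp [fun i => SimpleGraph.edist_eq_one_iff_adj.2 (h i)]

theorem properChains_succ_eq_empty {W : Type*} {G : SimpleGraph W} {ℓ : ℕ} :
    properChains G ℓ (ℓ + 1) = ∅ := by
  rw [Set.eq_empty_iff_forall_notMem]
  rintro x ⟨hx, hl⟩
  unfold length at hl
  have := Finset.card_nsmul_le_sum Finset.univ
    (fun i : Fin (ℓ + 1) => G.edist (x i.castSucc) (x i.succ)) 1 (fun i _ => by
      rw [Order.one_le_iff_ne_zero]
      exact fun h => hx i (SimpleGraph.edist_eq_zero_iff.1 h))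
  rw [hl] at this
  simp only [Finset.card_univ, Fintype.card_fin, nsmul_eq_mul, mul_one] at this
  have : ℓ + 1 ≤ ℓ := by exact_mod_cast this
  omega

end MagnitudeHomology

/-! ### Perturbing points and crossing hyperplanes. -/

section LinearForms

variable {V : Type*} [AddCommGroup V] [Module ℝ V]

theorem exists_dual_ker_eq {H : Submodule ℝ V} (h : Module.finrank ℝ (V ⧸ H) = 1) :
    ∃ f : Module.Dual ℝ V, LinearMap.ker f = H := by
  have : Module.Finite ℝ (V ⧸ H) := Module.finite_of_finrank_pos (by omega)
  have e : (V ⧸ H) ≃ₗ[ℝ] ℝ := LinearEquiv.ofFinrankEq _ _ (by rw [h, Module.finrank_self])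
  refine ⟨e.toLinearMap ∘ₗ H.mkQ, ?_⟩
  rw [LinearMap.ker_comp, LinearEquiv.ker, ← LinearMap.ker, Submodule.ker_mkQ]

theorem exists_smul_eq_of_ker_eq {f g : Module.Dual ℝ V} (hf : f ≠ 0)
    (h : LinearMap.ker g = LinearMap.ker f) : ∃ c : ℝ, c ≠ 0 ∧ ∀ x, g x = c * f x := by
  obtain ⟨v, hv⟩ : ∃ v, f v ≠ 0 := by
    by_contra! h
    exact hf (LinearMap.ext h)
  have hgv : g v ≠ 0 := fun h0 => hv (by
    rw [← LinearMap.mem_ker, ← h, LinearMap.mem_ker, h0])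
  refine ⟨g v / f v, div_ne_zero hgv hv, fun x => ?_⟩
  have hx : x - (f x / f v) • v ∈ LinearMap.ker g := by
    rw [h, LinearMap.mem_ker, map_sub, map_smul, smul_eq_mul, div_mul_cancel₀ _ hv, sub_self]
  rw [LinearMap.mem_ker, map_sub, map_smul, smul_eq_mul, sub_eq_zero] at hx
  rw [hx]
  field_simp

/-- Each nonzero sign at x persists for all small t > 0, and there are finitely many forms. -/
theorem exists_perturbation {ι : Type*} [Finite ι] (f : ι → Module.Dual ℝ V) (x y : V) :
    ∃ t : ℝ, 0 < t ∧ ∀ i, f i x ≠ 0 →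
      SignType.sign (f i (x + t • y)) = SignType.sign (f i x) := by
  have h : ∀ i, ∀ᶠ t in nhdsWithin (0 : ℝ) (Set.Ioi 0), f i x ≠ 0 →
      SignType.sign (f i (x + t • y)) = SignType.sign (f i x) := by
    intro i
    have hc : Filter.Tendsto (fun t : ℝ => f i (x + t • y)) (nhdsWithin (0 : ℝ) (Set.Ioi 0))
        (nhds (f i x)) := by
      have : Continuous fun t : ℝ => f i x + t * f i y := by fun_prop
      have h0 := (this.tendsto 0).mono_left (nhdsWithin_le_nhds (s := Set.Ioi 0))
      simpa using h0
    rcases lt_trichotomy (f i x) 0 with hx | hx | hx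
    · filter_upwards [hc.eventually (eventually_lt_nhds hx)] with t ht _
      rw [sign_neg hx, sign_neg ht]
    · exact Filter.Eventually.of_forall fun t h => absurd hx h
    · filter_upwards [hc.eventually (eventually_gt_nhds hx)] with t ht _
      rw [sign_pos hx, sign_pos ht]
  obtain ⟨t, h1, h2⟩ :=
    ((Filter.eventually_all.2 h).and self_mem_nhdsWithin).exists
  exact ⟨t, h2, h1⟩

/-- On a segment crossing the zero set of `g` there is a point where `g` vanishes and where every
linear form with the same sign at the two ends keeps this sign. -/
theorem exists_crossing {x y : V} {g : Module.Dual ℝ V} (hx : g x < 0) (hy : 0 < g y) :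
    ∃ z ∈ Submodule.span ℝ {x, y}, g z = 0 ∧ ∀ f : Module.Dual ℝ V,
      SignType.sign (f x) = SignType.sign (f y) →
        SignType.sign (f z) = SignType.sign (f x) := by
  -- Both coefficients are positive, so common signs persist, while the values of g cancel.
  refine ⟨g y • x + (-g x) • y, ?_, ?_, fun f hf => ?_⟩
  · exact Submodule.add_mem _ (Submodule.smul_mem _ _ (Submodule.subset_span (by simp)))
      (Submodule.smul_mem _ _ (Submodule.subset_span (by simp)))
  · simp; ring
  · have hx' : 0 < -g x := neg_pos.2 hx
    rw [map_add, map_smul, map_smul, smul_eq_mul, smul_eq_mul]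
    rcases lt_trichotomy (f x) 0 with h | h | h
    · have h2 : f y < 0 := by rwa [sign_neg h, eq_comm, sign_eq_neg_one_iff] at hf
      rw [sign_neg h, sign_eq_neg_one_iff]
      nlinarith [mul_pos hy (neg_pos.2 h), mul_pos hx' (neg_pos.2 h2)]
    · have h2 : f y = 0 := by rwa [h, sign_zero, eq_comm, sign_eq_zero_iff] at hf
      rw [h, h2]; simp
    · have h2 : 0 < f y := by rwa [sign_pos h, eq_comm, sign_eq_one_iff] at hf
      rw [sign_pos h, sign_eq_one_iff]
      positivity

end LinearForms

/-! ### Chambers as sign vectors; the tope graph inside the hypercube. -/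

namespace RealArrangement

open MagnitudeHomology

variable {V : Type*} [AddCommGroup V] [Module ℝ V] (A : RealArrangement V)

/-- A linear form with kernel `H`. -/
noncomputable def form (H : A.hyperplanes) : Module.Dual ℝ V :=
  (exists_dual_ker_eq (A.codim_eq_one H.1 H.2)).choose

theorem ker_form (H : A.hyperplanes) : LinearMap.ker (A.form H) = H.1 :=
  (exists_dual_ker_eq (A.codim_eq_one H.1 H.2)).choose_spec

theorem mem_iff_form (H : A.hyperplanes) (x : V) : x ∈ H.1 ↔ A.form H x = 0 := by
  rw [← A.ker_form H, LinearMap.mem_ker]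

theorem ne_top {H : Submodule ℝ V} (hH : H ∈ A.hyperplanes) : H ≠ ⊤ := by
  rintro rfl
  have := A.codim_eq_one _ hH
  have h2 : Subsingleton (V ⧸ (⊤ : Submodule ℝ V)) :=
    Submodule.Quotient.subsingleton_iff.2 rfl
  rw [Module.finrank_zero_of_subsingleton] at this
  omega

theorem form_ne_zero (H : A.hyperplanes) : A.form H ≠ 0 := by
  intro h
  have := A.ker_form H
  rw [h, LinearMap.ker_zero] at this
  exact A.ne_top H.2 this.symm

/-- Any other form with the same kernel is a nonzero multiple, so one chosen form per hyperplane
decides the face. -/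
theorem mk_eq_mk_iff (x y : V) :
    (Quotient.mk A.faceSetoid x : A.Face) = Quotient.mk A.faceSetoid y ↔
      ∀ H, SignType.sign (A.form H x) = SignType.sign (A.form H y) := by
  rw [Quotient.eq]
  constructor
  · intro h H
    exact h H.1 H.2 _ (A.ker_form H)
  · intro h H hH f hf
    obtain ⟨c, -, hfc⟩ := exists_smul_eq_of_ker_eq (A.form_ne_zero ⟨H, hH⟩)
      (hf.trans (A.ker_form ⟨H, hH⟩).symm)
    rw [hfc, hfc, sign_mul, sign_mul, h ⟨H, hH⟩]

variable {A}

/-- A point of a chamber. -/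
noncomputable def Chamber.point (C : A.Chamber) : V := Quotient.out C.1

theorem Chamber.mem_carrier_iff (C : A.Chamber) (x : V) : x ∈ C.carrier ↔
    ∀ H, SignType.sign (A.form H x) = SignType.sign (A.form H C.point) := by
  rw [← mk_eq_mk_iff, Chamber.point]
  change Quotient.mk A.faceSetoid x = C.1 ↔ _
  rw [show (Quotient.mk A.faceSetoid (Quotient.out C.1)) = C.1 from Quotient.out_eq _]

theorem Chamber.form_point_ne_zero (C : A.Chamber) (H : A.hyperplanes) :
    A.form H C.point ≠ 0 := by
  intro h
  exact Set.disjoint_left.1 (C.2 H.1 H.2) ((C.mem_carrier_iff _).2 fun _ => rfl)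
    ((A.mem_iff_form H _).2 h)

theorem Chamber.ext_sign {C D : A.Chamber}
    (h : ∀ H, SignType.sign (A.form H C.point) = SignType.sign (A.form H D.point)) : C = D := by
  refine Subtype.ext ?_
  rw [← mk_eq_mk_iff] at h
  rw [← show (Quotient.mk A.faceSetoid (Quotient.out C.1)) = C.1 from Quotient.out_eq _,
    ← show (Quotient.mk A.faceSetoid (Quotient.out D.1)) = D.1 from Quotient.out_eq _]
  exact h

theorem exists_chamber {x : V} (hx : ∀ H, A.form H x ≠ 0) : ∃ C : A.Chamber,
    ∀ H, SignType.sign (A.form H C.point) = SignType.sign (A.form H x) := by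
  let C : A.Chamber := ⟨Quotient.mk A.faceSetoid x, fun H hH => by
    rw [Set.disjoint_left]
    intro y hy hyH
    have := (A.mk_eq_mk_iff y x).1 hy ⟨H, hH⟩
    rw [(A.mem_iff_form ⟨H, hH⟩ y).1 hyH, sign_zero, eq_comm, sign_eq_zero_iff] at this
    exact hx _ this⟩
  refine ⟨C, fun H => ?_⟩
  exact ((C.mem_carrier_iff x).1 rfl H).symm

open Classical in
variable (A) in
/-- The sign vector of a chamber, with values in `ZMod 2`. -/
noncomputable def tope (C : A.Chamber) (H : A.hyperplanes) : ZMod 2 :=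
  if 0 < A.form H C.point then 1 else 0

theorem tope_eq_tope_iff {C D : A.Chamber} {H : A.hyperplanes} : A.tope C H = A.tope D H ↔
    SignType.sign (A.form H C.point) = SignType.sign (A.form H D.point) := by
  unfold tope
  rcases (C.form_point_ne_zero H).lt_or_gt with h1 | h1 <;>
  rcases (D.form_point_ne_zero H).lt_or_gt with h2 | h2 <;>
  simp [h1, h2, h1.not_gt, h2.not_gt]

theorem tope_injective : Function.Injective A.tope := fun _ _ h =>
  Chamber.ext_sign fun H => tope_eq_tope_iff.1 (congr_fun h H)

noncomputable instance : Fintype A.Chamber :=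
  @Fintype.ofFinite _ (Finite.of_injective _ (tope_injective (A := A)))

theorem separates_iff {C D : A.Chamber} (H : A.hyperplanes) :
    Separates H.1 C D ↔ A.tope C H ≠ A.tope D H := by
  have hC := (C.mem_carrier_iff _).2 fun _ => rfl
  have hD := (D.mem_carrier_iff _).2 fun _ => rfl
  constructor
  · rintro ⟨g, hg, h1, h2⟩ he
    obtain ⟨c, hc, hgc⟩ := exists_smul_eq_of_ker_eq (A.form_ne_zero H)
      (hg.trans (A.ker_form H).symm)
    rw [tope_eq_tope_iff] at he
    have h3 := h1 _ hC
    have h4 := h2 _ hD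
    have : SignType.sign (g C.point) = SignType.sign (g D.point) := by
      rw [hgc, hgc, sign_mul, sign_mul, he]
    rw [sign_neg h3, sign_pos h4] at this
    exact absurd this (by decide)
  · intro h
    rw [Ne, tope_eq_tope_iff] at h
    rcases (C.form_point_ne_zero H).lt_or_gt with h1 | h1 <;>
    rcases (D.form_point_ne_zero H).lt_or_gt with h2 | h2
    · simp [h1, h2] at h
    · refine ⟨A.form H, A.ker_form H, fun x hx => ?_, fun y hy => ?_⟩
      · rw [← sign_eq_neg_one_iff, (C.mem_carrier_iff x).1 hx, sign_neg h1]
      · rw [← sign_eq_one_iff, (D.mem_carrier_iff y).1 hy, sign_pos h2]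
    · refine ⟨-A.form H, ?_, fun x hx => ?_, fun y hy => ?_⟩
      · rw [← A.ker_form H]; ext; simp
      · rw [LinearMap.neg_apply, neg_lt_zero, ← sign_eq_one_iff, (C.mem_carrier_iff x).1 hx,
          sign_pos h1]
      · rw [LinearMap.neg_apply, neg_pos, ← sign_eq_neg_one_iff, (D.mem_carrier_iff y).1 hy,
          sign_neg h2]
    · simp [h1, h2] at h

open Classical in
theorem sep_eq (C D : A.Chamber) :
    A.sep C D = (Finset.univ.filter fun H => A.tope C H ≠ A.tope D H).image Subtype.val := by
  ext H
  simp only [sep, Finset.mem_filter, Finset.mem_image, Finset.mem_univ, true_and]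
  constructor
  · rintro ⟨hH, h⟩
    exact ⟨⟨H, hH⟩, (separates_iff ⟨H, hH⟩).1 h, rfl⟩
  · rintro ⟨H, h, rfl⟩
    exact ⟨H.2, (separates_iff H).2 h⟩

open Classical in
theorem tope_eq_add_single_iff {C D : A.Chamber} {K : A.hyperplanes} :
    A.tope D = A.tope C + Pi.single K 1 ↔
      (Finset.univ.filter fun H => A.tope C H ≠ A.tope D H) = {K} := by
  have h2 : ∀ a b : ZMod 2, b = a + 1 ↔ a ≠ b := by decide
  rw [funext_iff, Finset.ext_iff]
  refine forall_congr' fun H => ?_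
  rw [Finset.mem_filter, Finset.mem_singleton]
  by_cases hH : H = K
  · subst hH
    simp [h2]
  · simp [hH, eq_comm]

-- Supplies the hypercube hypothesis `hG` of the homological part.
open Classical in
theorem adj_iff (C D : A.Chamber) :
    A.topeGraph.Adj C D ↔ ∃ H, A.tope D = A.tope C + Pi.single H 1 := by
  change (A.sep C D).card = 1 ↔ _
  rw [sep_eq, Finset.card_image_of_injective _ Subtype.val_injective, Finset.card_eq_one]
  simp_rw [tope_eq_add_single_iff]

open Classical in
theorem crossed_eq {k : ℕ} {x : Fin (k + 1) → A.Chamber} {w : Fin k → A.hyperplanes}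
    (h : Trace A.tope x w) : A.crossed x = (Finset.univ.image w).image Subtype.val := by
  have hs : ∀ i : Fin k, A.sep (x i.castSucc) (x i.succ) = {(w i).1} := fun i => by
    rw [sep_eq, tope_eq_add_single_iff.1 (h i), Finset.image_singleton]
  unfold crossed
  simp_rw [hs]
  rw [Finset.image_image]
  ext H
  simp only [Finset.mem_biUnion, Finset.mem_univ, true_and, Finset.mem_singleton,
    Finset.mem_image, Function.comp]
  exact exists_congr fun i => eq_comm

open Classical in
theorem mem_properChains_iff {ℓ : ℕ} (x : Fin (ℓ + 1) → A.Chamber) :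
    x ∈ properChains A.topeGraph ℓ ℓ ↔ ∃ w, Trace A.tope x w := by
  rw [mem_properChains_diagonal]
  simp_rw [adj_iff]
  exact Classical.skolem

variable (A)

open Classical in
/-- The hyperplanes containing `X`. -/
noncomputable def above (X : Submodule ℝ V) : Finset A.hyperplanes :=
  Finset.univ.filter fun H => X ≤ H.1

/-- The intersection of a set of hyperplanes. -/
noncomputable def meet (B : Finset A.hyperplanes) : Submodule ℝ V := B.inf Subtype.val

open Classical in
theorem localization_eq (X : Submodule ℝ V) :
    A.localization X = (A.above X).image Subtype.val := by
  ext H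
  simp [localization, above, and_comm]

theorem card_localization (X : Submodule ℝ V) : (A.localization X).card = (A.above X).card := by
  classical
  rw [localization_eq, Finset.card_image_of_injective _ Subtype.val_injective]

theorem mem_meet {B : Finset A.hyperplanes} {x : V} :
    x ∈ A.meet B ↔ ∀ H ∈ B, A.form H x = 0 := by
  unfold meet
  rw [Submodule.mem_finsetInf]
  simp_rw [mem_iff_form]

theorem mem_above {X : Submodule ℝ V} {H : A.hyperplanes} : H ∈ A.above X ↔ X ≤ H.1 := by
  simp [above]

theorem meet_mem_flats (B : Finset A.hyperplanes) : A.meet B ∈ A.flats := by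
  classical
  unfold flats
  rw [Finset.mem_image]
  refine ⟨B.image Subtype.val, ?_, ?_⟩
  · rw [Finset.mem_powerset]
    intro H hH
    obtain ⟨K, -, rfl⟩ := Finset.mem_image.1 hH
    exact K.2
  · rw [Finset.inf_image]; rfl

theorem meet_above {X : Submodule ℝ V} (hX : X ∈ A.flats) : A.meet (A.above X) = X := by
  classical
  unfold flats at hX
  obtain ⟨B, hB, rfl⟩ := Finset.mem_image.1 hX
  rw [Finset.mem_powerset] at hB
  apply le_antisymm
  · refine Finset.le_inf fun H hH => ?_
    have : (⟨H, hB hH⟩ : A.hyperplanes) ∈ A.above (B.inf id) :=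
      A.mem_above.2 (Finset.inf_le (f := id) hH)
    exact Finset.inf_le (f := Subtype.val) this
  · exact Finset.le_inf fun H hH => A.mem_above.1 hH

/-- The codimension of the common kernel is the dimension of the range of the evaluation map into
ℝ^B. -/
theorem rank_meet_eq_iff (B : Finset A.hyperplanes) : rank (A.meet B) = B.card ↔
    Function.Surjective (LinearMap.pi fun H : B => A.form H.1) := by
  have hk : LinearMap.ker (LinearMap.pi fun H : B => A.form H.1) = A.meet B := by
    ext x
    rw [mem_meet, LinearMap.mem_ker, funext_iff]
    simp
  unfold rank
  rw [← hk, LinearEquiv.finrank_eq (LinearMap.quotKerEquivRange _), ← LinearMap.range_eq_top]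
  constructor
  · intro h
    exact Submodule.eq_top_of_finrank_eq (by rw [h]; simp)
  · intro h
    rw [h]
    simp

/-! ### Cubes of chambers correspond to Boolean flats. -/

variable {A}

theorem CubeAt.exists_sign {C : A.Chamber} {B : Finset A.hyperplanes} [DecidableEq A.hyperplanes]
    (h : CubeAt A.tope C B) {S : Finset A.hyperplanes} (hS : S ⊆ B) :
    ∃ D : A.Chamber, ∀ H, A.tope D H = A.tope C H + if H ∈ S then 1 else 0 := by
  obtain ⟨D, hD⟩ := h S hS
  exact ⟨D, congr_fun hD⟩

/-- The forms of B are made to vanish one at a time: two points with opposite signs only at K yield,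
on their segment, a point of K with all other zeros and signs kept. The induction must carry every
sign change on B \ T, since each step uses both S and `insert K S`. -/
theorem CubeAt.exists_point {C : A.Chamber} {B : Finset A.hyperplanes}
    [DecidableEq A.hyperplanes] (h : CubeAt A.tope C B) :
    ∃ x, (∀ H ∈ B, A.form H x = 0) ∧
      ∀ H ∉ B, SignType.sign (A.form H x) = SignType.sign (A.form H C.point) := by
  suffices key : ∀ T : Finset A.hyperplanes, T ⊆ B → ∀ S ⊆ B \ T, ∃ x,
      (∀ H ∈ T, A.form H x = 0) ∧
        ∀ H ∉ T, SignType.sign (A.form H x) = if H ∈ S then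
          -SignType.sign (A.form H C.point) else SignType.sign (A.form H C.point) by
    obtain ⟨x, h1, h2⟩ := key B subset_rfl ∅ (Finset.empty_subset _)
    exact ⟨x, h1, fun H hH => by simpa using h2 H hH⟩
  intro T
  induction T using Finset.induction_on with
  | empty =>
    intro _ S hS
    obtain ⟨D, hD⟩ := CubeAt.exists_sign h (hS.trans Finset.sdiff_subset)
    refine ⟨D.point, by simp, fun H _ => ?_⟩
    have := hD H
    split_ifs at this ⊢ with hHS
    · have hne : A.tope D H ≠ A.tope C H := by
        rw [this]; generalize A.tope C H = z; revert z; decide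
      rw [Ne, tope_eq_tope_iff] at hne
      have s1 : SignType.sign (A.form H D.point) ≠ 0 :=
        mt sign_eq_zero_iff.1 (D.form_point_ne_zero H)
      have s2 : SignType.sign (A.form H C.point) ≠ 0 :=
        mt sign_eq_zero_iff.1 (C.form_point_ne_zero H)
      revert hne s1 s2
      generalize SignType.sign (A.form H D.point) = a
      generalize SignType.sign (A.form H C.point) = b
      revert a b
      decide
    · rw [add_zero, tope_eq_tope_iff] at this
      exact this
  | insert K T hK ih =>
    intro hT S hS
    have hT' : T ⊆ B := (Finset.subset_insert _ _).trans hT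
    have hKB : K ∈ B := hT (Finset.mem_insert_self _ _)
    have hKS : K ∉ S := fun hk => by
      have := hS hk
      simp at this
    have hS1 : S ⊆ B \ T := hS.trans (Finset.sdiff_subset_sdiff subset_rfl
      (Finset.subset_insert _ _))
    have hS2 : insert K S ⊆ B \ T := by
      rw [Finset.insert_subset_iff]
      exact ⟨Finset.mem_sdiff.2 ⟨hKB, hK⟩, hS1⟩
    obtain ⟨x, hx1, hx2⟩ := ih hT' S hS1
    obtain ⟨y, hy1, hy2⟩ := ih hT' _ hS2
    have hxK := hx2 K hK
    have hyK := hy2 K hK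
    rw [if_neg hKS] at hxK
    rw [if_pos (Finset.mem_insert_self _ _)] at hyK
    have main : ∃ z, A.form K z = 0 ∧ ∀ f : Module.Dual ℝ V,
        SignType.sign (f x) = SignType.sign (f y) →
          SignType.sign (f z) = SignType.sign (f x) := by
      rcases (C.form_point_ne_zero K).lt_or_gt with h1 | h1
      · rw [sign_neg h1, sign_eq_neg_one_iff] at hxK
        rw [sign_neg h1, neg_neg, sign_eq_one_iff] at hyK
        obtain ⟨z, -, hz, hz'⟩ := exists_crossing hxK hyK
        exact ⟨z, hz, hz'⟩
      · rw [sign_pos h1, sign_eq_one_iff] at hxK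
        rw [sign_pos h1, sign_eq_neg_one_iff] at hyK
        obtain ⟨z, -, hz, hz'⟩ := exists_crossing hyK hxK
        exact ⟨z, hz, fun f hf => (hz' f hf.symm).trans hf.symm⟩
    obtain ⟨z, hz, hz'⟩ := main
    refine ⟨z, fun H hH => ?_, fun H hH => ?_⟩
    · rcases Finset.mem_insert.1 hH with rfl | hH
      · exact hz
      · have := hz' (A.form H) (by rw [hx1 H hH, hy1 H hH])
        rwa [hx1 H hH, sign_zero, sign_eq_zero_iff] at this
    · rw [Finset.mem_insert, not_or] at hH
      have e : (H ∈ insert K S) ↔ H ∈ S := by simp [hH.1]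
      rw [hz' (A.form H) (by rw [hx2 H hH.2, hy2 H hH.2]; simp only [e]), hx2 H hH.2]

/-- If the range lay in the kernel of g ≠ 0, take the chamber D of the cube whose signs match the
coefficients of g. Evaluating g there gives a sum of nonnegative terms equal to 0; as no form
vanishes at D, all coefficients vanish. -/
theorem CubeAt.surjective {C : A.Chamber} {B : Finset A.hyperplanes}
    [DecidableEq A.hyperplanes] (h : CubeAt A.tope C B) :
    Function.Surjective (LinearMap.pi fun H : B => A.form H.1) := by
  rw [← LinearMap.range_eq_top]
  by_contra hne
  obtain ⟨g, hg0, hg⟩ := Submodule.exists_le_ker_of_lt_top _ (lt_top_iff_ne_top.2 hne)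
  apply hg0
  have hgs : ∀ y : B → ℝ, g y = ∑ H, y H * g (Pi.single H 1) := fun y => by
    rw [LinearMap.pi_apply_eq_sum_univ g y]
    simp only [smul_eq_mul]
    refine Finset.sum_congr rfl fun H _ => ?_
    congr 2
    ext K
    simp [Pi.single_apply, eq_comm]
  have hsign : ∃ D : A.Chamber, ∀ H : B, 0 < g (Pi.single H 1) ↔ A.tope D H.1 = 1 := by
    classical
    -- The signs of C are flipped exactly where they disagree with g.
    obtain ⟨D, hD⟩ := CubeAt.exists_sign h (S := B.filter fun H =>
      ∃ hH : H ∈ B, ¬ (0 < g (Pi.single ⟨H, hH⟩ 1) ↔ A.tope C H = 1)) (Finset.filter_subset _ _)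
    refine ⟨D, fun H => ?_⟩
    rw [hD]
    have e : ((H : A.hyperplanes) ∈ B.filter fun H =>
      ∃ hH : H ∈ B, ¬ (0 < g (Pi.single ⟨H, hH⟩ 1) ↔ A.tope C H = 1)) ↔
        ¬ (0 < g (Pi.single H 1) ↔ A.tope C H = 1) := by simp
    rw [if_congr e rfl rfl]
    have h2 : ∀ z : ZMod 2, z + 1 = 1 ↔ ¬ z = 1 := by decide
    split_ifs with h3
    · rw [add_zero]; exact h3
    · rw [h2]; tauto
  obtain ⟨D, hD⟩ := hsign
  have h0 : ∑ H : B, A.form H.1 D.point * g (Pi.single H 1) = 0 := by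
    rw [← hgs fun H => A.form H.1 D.point]
    exact LinearMap.mem_ker.1 (hg ⟨D.point, rfl⟩)
  have hpos : ∀ H : B, 0 ≤ A.form H.1 D.point * g (Pi.single H 1) := fun H => by
    have := hD H
    unfold tope at this
    by_cases hp : 0 < A.form H.1 D.point
    · rw [if_pos hp] at this
      exact (mul_pos hp (this.2 rfl)).le
    · rw [if_neg hp] at this
      exact mul_nonneg_of_nonpos_of_nonpos (not_lt.1 hp) (not_lt.1 fun h => by
        exact absurd (this.1 h) (by decide))
  have hz := (Finset.sum_eq_zero_iff_of_nonneg fun H _ => hpos H).1 h0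
  ext y
  simp only [LinearMap.comp_apply, LinearMap.single_apply, LinearMap.zero_apply]
  exact (mul_eq_zero.1 (hz y (Finset.mem_univ _))).resolve_left (D.form_point_ne_zero _)

/-- The centre of the cube lies in the intersection of B but on no hyperplane outside B. -/
theorem CubeAt.above_meet {C : A.Chamber} {B : Finset A.hyperplanes}
    [DecidableEq A.hyperplanes] (h : CubeAt A.tope C B) : A.above (A.meet B) = B := by
  ext H
  rw [mem_above]
  constructor
  · intro hH
    by_contra hB
    obtain ⟨x, h1, h2⟩ := CubeAt.exists_point h
    have := h2 H hB
    rw [(A.mem_iff_form H x).1 (hH (A.mem_meet.2 h1)), sign_zero, eq_comm,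
      sign_eq_zero_iff] at this
    exact C.form_point_ne_zero H this
  · intro hH
    exact Finset.inf_le (f := Subtype.val) hH

-- A face is open in the intersection of the hyperplanes through any of its points, so small moves
-- along that subspace stay in the face and span it.
open Classical in
theorem support_mk (x : V) : Face.support (Quotient.mk A.faceSetoid x : A.Face) =
    A.meet (Finset.univ.filter fun H => A.form H x = 0) := by
  apply le_antisymm
  · refine Submodule.span_le.2 fun y hy => ?_
    rw [SetLike.mem_coe, mem_meet]
    intro H hH
    have := (A.mk_eq_mk_iff y x).1 hy H
    rwa [(Finset.mem_filter.1 hH).2, sign_zero, sign_eq_zero_iff] at this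
  · intro z hz
    rw [mem_meet] at hz
    obtain ⟨t, ht, h⟩ := exists_perturbation A.form x z
    have hx : x ∈ Face.support (Quotient.mk A.faceSetoid x : A.Face) :=
      Submodule.subset_span rfl
    have hxz : x + t • z ∈ Face.support (Quotient.mk A.faceSetoid x : A.Face) := by
      refine Submodule.subset_span ((A.mk_eq_mk_iff _ _).2 fun H => ?_)
      by_cases hH : A.form H x = 0
      · rw [map_add, map_smul, hH, hz H (by simp [hH])]
        simp
      · exact h H hH
    have := Submodule.smul_mem _ t⁻¹ (Submodule.sub_mem _ hxz hx)
    rwa [add_sub_cancel_left, smul_smul, inv_mul_cancel₀ ht.ne', one_smul] at this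

theorem support_mk_eq_iff {X : Submodule ℝ V} (hX : X ∈ A.flats) (x : V) :
    Face.support (Quotient.mk A.faceSetoid x : A.Face) = X ↔
      ∀ H, A.form H x = 0 ↔ H ∈ A.above X := by
  classical
  rw [support_mk]
  constructor
  · rintro rfl H
    rw [mem_above]
    constructor
    · intro h
      exact Finset.inf_le (f := Subtype.val) (by simp [h])
    · intro h
      exact (A.mem_iff_form H x).1 (h (A.mem_meet.2 fun K hK => (Finset.mem_filter.1 hK).2))
  · intro h
    rw [← A.meet_above hX]
    congr 1
    ext H
    simp [h]

/-- Independence of the forms of B provides a direction with prescribed signs on B; a small move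
from x along it keeps the other signs. -/
theorem exists_tope_eq {B : Finset A.hyperplanes} [DecidableEq A.hyperplanes]
    (hB : rank (A.meet B) = B.card) {x : V} (hx : ∀ H, A.form H x = 0 ↔ H ∈ B)
    (s : A.hyperplanes → ZMod 2) : ∃ D : A.Chamber, (∀ H ∈ B, A.tope D H = s H) ∧
      ∀ H ∉ B, SignType.sign (A.form H D.point) = SignType.sign (A.form H x) := by
  obtain ⟨y, hy⟩ := (A.rank_meet_eq_iff B).1 hB fun H => if s H.1 = 1 then 1 else -1
  obtain ⟨t, ht, h⟩ := exists_perturbation A.form x y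
  have hB' : ∀ H ∈ B, A.form H (x + t • y) = t * if s H = 1 then 1 else -1 := fun H hH => by
    have := congr_fun hy ⟨H, hH⟩
    simp only [LinearMap.pi_apply] at this
    rw [map_add, map_smul, this, (hx H).2 hH, zero_add, smul_eq_mul]
  have hne : ∀ H, A.form H (x + t • y) ≠ 0 := fun H => by
    by_cases hH : H ∈ B
    · rw [hB' H hH]
      split_ifs <;> simp [ht.ne']
    · have := h H (mt (hx H).1 hH)
      intro h0
      rw [h0, sign_zero, eq_comm, sign_eq_zero_iff, hx] at this
      exact hH this
  obtain ⟨D, hD⟩ := exists_chamber hne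
  refine ⟨D, fun H hH => ?_, fun H hH => (hD H).trans (h H (mt (hx H).1 hH))⟩
  have h3 := hD H
  rw [hB' H hH] at h3
  have h01 : ∀ z : ZMod 2, z = 0 ∨ z = 1 := by decide
  unfold tope
  rcases h01 (s H) with h | h
  · rw [h, if_neg (show ¬ (0 : ZMod 2) = 1 by decide), sign_neg (show t * -1 < 0 by linarith),
      sign_eq_neg_one_iff] at h3
    rw [if_neg h3.not_gt, h]
  · rw [h, if_pos rfl, sign_pos (show 0 < t * 1 by linarith), sign_eq_one_iff] at h3
    rw [if_pos h3, h]

theorem card_cubeAt_eq_zero {B : Finset A.hyperplanes} [DecidableEq A.hyperplanes]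
    (h : ¬ (A.above (A.meet B) = B ∧ rank (A.meet B) = B.card)) :
    Nat.card {C : A.Chamber // CubeAt A.tope C B} = 0 := by
  rw [Nat.card_eq_zero]
  exact Or.inl ⟨fun C => h ⟨CubeAt.above_meet C.2,
    (A.rank_meet_eq_iff B).2 (CubeAt.surjective C.2)⟩⟩

/-- A chamber in a cube is encoded by the face of the cube's centre and by its own signs on B. -/
theorem card_cubeAt {B : Finset A.hyperplanes} [DecidableEq A.hyperplanes]
    (h1 : A.above (A.meet B) = B) (h2 : rank (A.meet B) = B.card) :
    Nat.card {C : A.Chamber // CubeAt A.tope C B} = A.faceCount (A.meet B) * 2 ^ B.card := by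
  have hpt := fun C : {C : A.Chamber // CubeAt A.tope C B} => CubeAt.exists_point C.2
  choose pt hpt1 hpt2 using hpt
  have hsupp : ∀ x : V, Face.support (Quotient.mk A.faceSetoid x : A.Face) = A.meet B ↔
      ∀ H, A.form H x = 0 ↔ H ∈ B := fun x => by
    rw [support_mk_eq_iff (A.meet_mem_flats B), h1]
  have hzero : ∀ C H, A.form H (pt C) = 0 ↔ H ∈ B := fun C H => by
    refine ⟨fun h => ?_, hpt1 C H⟩
    by_contra hH
    have := hpt2 C H hH
    rw [h, sign_zero, eq_comm, sign_eq_zero_iff] at this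
    exact C.1.form_point_ne_zero H this
  let f : {C : A.Chamber // CubeAt A.tope C B} →
      {F : A.Face // F.support = A.meet B} × (B → ZMod 2) := fun C =>
    (⟨Quotient.mk A.faceSetoid (pt C), (hsupp _).2 (hzero C)⟩, fun H => A.tope C.1 H.1)
  have hf : Function.Bijective f := by
    constructor
    · intro C D hCD
      refine Subtype.ext (tope_injective (funext fun H => ?_))
      by_cases hH : H ∈ B
      · exact congr_fun (congr_arg Prod.snd hCD) ⟨H, hH⟩
      · have := (A.mk_eq_mk_iff _ _).1 (congr_arg (fun z => z.1.1) hCD) H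
        rw [tope_eq_tope_iff, ← hpt2 C H hH, ← hpt2 D H hH, this]
    · rintro ⟨⟨F, hF⟩, s⟩
      obtain ⟨x, rfl⟩ := Quotient.exists_rep F
      have hx := (hsupp x).1 hF
      obtain ⟨C, hC1, hC2⟩ := exists_tope_eq h2 hx
        (fun H => if hH : H ∈ B then s ⟨H, hH⟩ else 0)
      have hcube : CubeAt A.tope C B := by
        intro S hS
        obtain ⟨D, hD1, hD2⟩ := exists_tope_eq h2 hx
          (fun H => A.tope C H + if H ∈ S then 1 else 0)
        refine ⟨D, funext fun H => ?_⟩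
        by_cases hH : H ∈ B
        · exact hD1 H hH
        · rw [Pi.add_apply, if_neg fun h => hH (hS h), add_zero, tope_eq_tope_iff,
            hD2 H hH, hC2 H hH]
      refine ⟨⟨C, hcube⟩, Prod.ext (Subtype.ext ((A.mk_eq_mk_iff _ _).2 fun H => ?_))
        (funext fun H => ?_)⟩
      · by_cases hH : H ∈ B
        · rw [(hzero _ H).2 hH, (hx H).2 hH]
        · rw [hpt2 _ H hH, hC2 H hH]
      · change A.tope C H.1 = s H
        rw [hC1 H.1 H.2, dif_pos H.2]
  rw [Nat.card_congr (Equiv.ofBijective f hf), Nat.card_prod, faceCount]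
  congr 1
  simp [Nat.card_eq_fintype_card, ZMod.card]

end RealArrangement

/-! ### Whitney's region count by deletion and restriction. -/

section Whitney

variable {V ι : Type*} [AddCommGroup V] [Module ℝ V] (f : ι → Module.Dual ℝ V)

/-- The sign vectors on `s` without zeros which the forms `f i` take on `U`, extended by zero. -/
def signPatterns (U : Submodule ℝ V) (s : Finset ι) : Set (ι → SignType) :=
  {σ | (∀ i, σ i ≠ 0 ↔ i ∈ s) ∧ ∃ x ∈ U, ∀ i ∈ s, SignType.sign (f i x) = σ i}

theorem finrank_inf_ker_add_one [FiniteDimensional ℝ V] {U : Submodule ℝ V}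
    {g : Module.Dual ℝ V} {z : V} (hz : z ∈ U) (hgz : g z ≠ 0) :
    Module.finrank ℝ ↥(U ⊓ LinearMap.ker g) + 1 = Module.finrank ℝ U := by
  have h1 := Module.Dual.finrank_ker_add_one_of_ne_zero (f := g)
    (fun h => hgz (by rw [h, LinearMap.zero_apply]))
  have h2 := Submodule.finrank_sup_add_finrank_inf_eq U (LinearMap.ker g)
  have h3 : LinearMap.ker g < U ⊔ LinearMap.ker g :=
    lt_of_le_not_ge le_sup_right fun h => hgz (h (Submodule.mem_sup_left hz))
  have h4 := Submodule.finrank_lt_finrank_of_lt h3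
  have h5 := Submodule.finrank_le (U ⊔ LinearMap.ker g)
  omega

variable {f}

theorem signPatterns_empty (U : Submodule ℝ V) : signPatterns f U ∅ = {0} := by
  ext σ
  constructor
  · rintro ⟨h, -⟩
    ext i
    exact not_not.1 (mt (h i).1 (Finset.notMem_empty i))
  · rintro rfl
    exact ⟨by simp, 0, U.zero_mem, by simp⟩

theorem mem_signPatterns_perturb [Finite ι] {U : Submodule ℝ V} {s : Finset ι} {σ : ι → SignType}
    (hσ : ∀ i, σ i ≠ 0 ↔ i ∈ s) {x z : V} (hx : x ∈ U) (hz : z ∈ U)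
    (hxs : ∀ i ∈ s, SignType.sign (f i x) = σ i) {h : ι} (hh : f h x = 0) :
    ∃ y ∈ U, (∀ i ∈ s, SignType.sign (f i y) = σ i) ∧
      SignType.sign (f h y) = SignType.sign (f h z) := by
  obtain ⟨t, ht, hp⟩ := exists_perturbation f x z
  refine ⟨x + t • z, U.add_mem hx (U.smul_mem _ hz), fun i hi => ?_, ?_⟩
  · rw [hp i, hxs i hi]
    intro h0
    have := hxs i hi
    rw [h0, sign_zero] at this
    exact (hσ i).2 hi this.symm
  · rw [map_add, map_smul, hh, zero_add, smul_eq_mul, sign_mul, sign_pos ht, one_mul]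

/-- Let N ε be the patterns on s realised on side ε of h. The union of N 1 and N (-1) is all
patterns on U, their intersection (by crossing and perturbation) the patterns on the restriction;
inclusion-exclusion concludes. -/
theorem ncard_signPatterns_insert [Finite ι] [DecidableEq ι] {U : Submodule ℝ V} {s : Finset ι}
    {h : ι} (hs : h ∉ s) {z : V} (hz : z ∈ U) (hhz : f h z ≠ 0) :
    (signPatterns f U (insert h s)).ncard = (signPatterns f U s).ncard +
      (signPatterns f (U ⊓ LinearMap.ker (f h)) s).ncard := by
  let N : SignType → Set (ι → SignType) := fun ε => {σ | (∀ i, σ i ≠ 0 ↔ i ∈ s) ∧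
    ∃ x ∈ U, (∀ i ∈ s, SignType.sign (f i x) = σ i) ∧ SignType.sign (f h x) = ε}
  obtain ⟨a, haU, ha⟩ : ∃ a ∈ U, 0 < f h a := by
    rcases hhz.lt_or_gt with h1 | h1
    · exact ⟨-z, U.neg_mem hz, by simpa using h1⟩
    · exact ⟨z, hz, h1⟩
  have haU' := U.neg_mem haU
  have ha' : f h (-a) < 0 := by simpa using ha
  have hunion : N 1 ∪ N (-1) = signPatterns f U s := by
    ext σ
    constructor
    · rintro (⟨h1, x, hx, hxs, -⟩ | ⟨h1, x, hx, hxs, -⟩) <;> exact ⟨h1, x, hx, hxs⟩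
    · rintro ⟨h1, x, hx, hxs⟩
      rcases lt_trichotomy (f h x) 0 with h0 | h0 | h0
      · exact Or.inr ⟨h1, x, hx, hxs, sign_neg h0⟩
      · obtain ⟨y, hy, hys, hyh⟩ := mem_signPatterns_perturb h1 hx haU hxs h0
        exact Or.inl ⟨h1, y, hy, hys, hyh.trans (sign_pos ha)⟩
      · exact Or.inl ⟨h1, x, hx, hxs, sign_pos h0⟩
  have hinter : N 1 ∩ N (-1) = signPatterns f (U ⊓ LinearMap.ker (f h)) s := by
    ext σ
    constructor
    · rintro ⟨⟨h1, x, hx, hxs, hxh⟩, -, y, hy, hys, hyh⟩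
      obtain ⟨w, hw, hw0, hws⟩ :=
        exists_crossing (sign_eq_neg_one_iff.1 hyh) (sign_eq_one_iff.1 hxh)
      refine ⟨h1, w, ⟨?_, hw0⟩, fun i hi => ?_⟩
      · refine Submodule.span_le.2 ?_ hw
        rintro v (rfl | rfl)
        · exact hy
        · exact hx
      · rw [hws _ (by rw [hxs i hi, hys i hi]), hys i hi]
    · rintro ⟨h1, x, ⟨hx, hx0⟩, hxs⟩
      obtain ⟨y, hy, hys, hyh⟩ := mem_signPatterns_perturb h1 hx haU hxs hx0
      obtain ⟨y', hy', hys', hyh'⟩ := mem_signPatterns_perturb h1 hx haU' hxs hx0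
      exact ⟨⟨h1, y, hy, hys, hyh.trans (sign_pos ha)⟩,
        ⟨h1, y', hy', hys', hyh'.trans (sign_neg ha')⟩⟩
  have himage : signPatterns f U (insert h s) =
      (fun σ => Function.update σ h 1) '' N 1 ∪ (fun σ => Function.update σ h (-1)) '' N (-1) := by
    have hupd : ∀ ε : SignType, ε ≠ 0 → ∀ σ ∈ N ε,
        Function.update σ h ε ∈ signPatterns f U (insert h s) := by
      rintro ε hε σ ⟨h1, x, hx, hxs, hxh⟩
      refine ⟨fun i => ?_, x, hx, fun i hi => ?_⟩
      · by_cases hi : i = h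
        · subst hi; simp [hε]
        · simp [hi, h1]
      · by_cases hih : i = h
        · subst hih; simp [hxh]
        · rw [Function.update_of_ne hih, hxs i ((Finset.mem_insert.1 hi).resolve_left hih)]
    have hback : ∀ σ ∈ signPatterns f U (insert h s),
        Function.update σ h 0 ∈ N (σ h) := by
      rintro σ ⟨h1, x, hx, hxs⟩
      refine ⟨fun i => ?_, x, hx, fun i hi => ?_, hxs h (Finset.mem_insert_self _ _)⟩
      · by_cases hi : i = h
        · subst hi; simp [hs]
        · simp [hi, h1]
      · have : i ≠ h := by rintro rfl; exact hs hi
        rw [Function.update_of_ne this, hxs i (Finset.mem_insert_of_mem hi)]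
    ext σ
    constructor
    · intro hσ
      have h0 : σ h ≠ 0 := (hσ.1 h).2 (Finset.mem_insert_self _ _)
      have h2 : σ h = 1 ∨ σ h = -1 := by
        generalize σ h = b at h0
        revert b
        decide
      have h3 := hback σ hσ
      rcases h2 with h2 | h2
      · exact Or.inl ⟨_, h2 ▸ h3, by simp [← h2]⟩
      · exact Or.inr ⟨_, h2 ▸ h3, by simp [← h2]⟩
    · rintro (⟨τ, hτ, rfl⟩ | ⟨τ, hτ, rfl⟩)
      · exact hupd 1 (by decide) τ hτ
      · exact hupd (-1) (by decide) τ hτ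
  have hinj : ∀ ε δ : SignType, Set.InjOn (fun σ : ι → SignType => Function.update σ h ε) (N δ) := by
    rintro ε δ σ ⟨h1, -⟩ τ ⟨h2, -⟩ he
    ext i
    by_cases hi : i = h
    · subst hi
      rw [not_not.1 (mt (h1 i).1 hs), not_not.1 (mt (h2 i).1 hs)]
    · have := congr_fun he i
      simpa [hi] using this
  have hdisj : Disjoint ((fun σ => Function.update σ h 1) '' N 1)
      ((fun σ => Function.update σ h (-1)) '' N (-1)) := by
    rw [Set.disjoint_left]
    rintro _ ⟨σ, -, rfl⟩ ⟨τ, -, he⟩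
    have := congr_fun he h
    simp only [Function.update_self] at this
    exact absurd this (by decide)
  rw [himage, Set.ncard_union_eq hdisj (Set.toFinite _) (Set.toFinite _),
    (hinj _ _).ncard_image, (hinj _ _).ncard_image,
    ← Set.ncard_union_add_ncard_inter _ _ (Set.toFinite _) (Set.toFinite _), hunion, hinter]

/-- **Whitney's formula** for the number of regions of a family of linear forms on a subspace. -/
theorem ncard_signPatterns [Finite ι] [DecidableEq ι] [FiniteDimensional ℝ V] (s : Finset ι)
    (U : Submodule ℝ V) :
    ((signPatterns f U s).ncard : ℤ) = ∑ B ∈ s.powerset, (-1) ^ (B.card + (Module.finrank ℝ U +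
      Module.finrank ℝ ↥(U ⊓ B.inf fun i => LinearMap.ker (f i)))) := by
  induction s using Finset.induction_on generalizing U with
  | empty =>
    rw [signPatterns_empty, Set.ncard_singleton, Finset.powerset_empty, Finset.sum_singleton, Finset.inf_empty,
      inf_top_eq]
    simp [← two_mul]
  | insert h s hs ih =>
    rw [Finset.sum_powerset_insert hs]
    -- Subsets containing h give the sum for the restriction to ker (f h), up to a sign that is + if
    -- f h is nonzero on U and - otherwise; in the latter case the two halves cancel.
    have hins : ∀ B ∈ s.powerset, (-1 : ℤ) ^ ((insert h B).card + (Module.finrank ℝ U +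
        Module.finrank ℝ ↥(U ⊓ (insert h B).inf fun i => LinearMap.ker (f i)))) =
        (-1) ^ (Module.finrank ℝ U + Module.finrank ℝ ↥(U ⊓ LinearMap.ker (f h)) + 1) *
          (-1) ^ (B.card + (Module.finrank ℝ ↥(U ⊓ LinearMap.ker (f h)) +
            Module.finrank ℝ ↥(U ⊓ LinearMap.ker (f h) ⊓ B.inf fun i => LinearMap.ker (f i)))) := by
      intro B hB
      rw [Finset.card_insert_of_notMem fun hb => hs (Finset.mem_powerset.1 hB hb),
        Finset.inf_insert, ← inf_assoc]
      have h1 : ∀ n : ℕ, (-1 : ℤ) ^ n * (-1) ^ n = 1 := fun n => by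
        rw [← pow_add, ← two_mul]; simp
      rw [pow_add, pow_add, pow_add, pow_add, pow_add, pow_add, pow_add]
      linear_combination (-(-1 : ℤ) ^ B.card * (-1) ^ 1 * (-1) ^ Module.finrank ℝ U *
        (-1) ^ Module.finrank ℝ
          ↥(U ⊓ LinearMap.ker (f h) ⊓ B.inf fun i => LinearMap.ker (f i))) *
        h1 (Module.finrank ℝ ↥(U ⊓ LinearMap.ker (f h)))
    rw [Finset.sum_congr rfl hins, ← Finset.mul_sum, ← ih, ← ih]
    by_cases hU : ∃ z ∈ U, f h z ≠ 0
    · obtain ⟨z, hz, hz'⟩ := hU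
      rw [ncard_signPatterns_insert hs hz hz', ← finrank_inf_ker_add_one hz hz']
      set n := Module.finrank ℝ ↥(U ⊓ LinearMap.ker (f h))
      rw [show n + 1 + n + 1 = 2 * (n + 1) by ring, pow_mul]
      simp
    · push Not at hU
      have h1 : U ⊓ LinearMap.ker (f h) = U := inf_eq_left.2 fun z hz => hU z hz
      have h2 : signPatterns f U (insert h s) = ∅ := by
        rw [Set.eq_empty_iff_forall_notMem]
        rintro σ ⟨h3, x, hx, hxs⟩
        have := hxs h (Finset.mem_insert_self _ _)
        rw [hU x hx, sign_zero] at this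
        exact (h3 h).2 (Finset.mem_insert_self _ _) this.symm
      rw [h1, h2, ← two_mul, pow_add, pow_mul]
      simp

end Whitney

/-! ### The rank formula and its invariance under lattice isomorphism. -/

namespace RealArrangement

open MagnitudeHomology

variable {V : Type*} [AddCommGroup V] [Module ℝ V] (A : RealArrangement V)

/-- The diagonal magnitude homology is free of finite rank, with a formula for the rank valid
in all degrees. -/
theorem diagonal_MH (ℓ : ℕ) : Module.Free ℤ (A.MH ℓ ℓ) ∧ Module.Finite ℤ (A.MH ℓ ℓ) ∧
    A.beta ℓ ℓ = ∑ X ∈ A.booleanFlats,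
      A.faceCount X * 2 ^ rank X * surjCount ℓ (rank X) := by
  classical
  obtain ⟨h1, h2, h3⟩ := diagonal_homology (p := A.tope) (G := A.topeGraph)
    (P := properChains A.topeGraph ℓ) (ℓ := ℓ) (Q := fun _ => True) tope_injective adj_iff
    (fun x => by simp [mem_properChains_iff]) properChains_succ_eq_empty
  refine ⟨h1, h2, h3.trans ?_⟩
  rw [card_diagIndex]
  simp only [Finset.filter_true]
  -- Sets B not of the form A_X with X Boolean carry no cube; the others correspond to Boolean flats
  -- by `meet` and `above`.
  rw [← Finset.sum_filter_of_ne
    (p := fun B => A.above (A.meet B) = B ∧ rank (A.meet B) = B.card)]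
  · refine Finset.sum_nbij' A.meet A.above ?_ ?_ ?_ ?_ ?_
    · intro B hB
      obtain ⟨-, hB1, hB2⟩ := Finset.mem_filter.1 hB
      refine Finset.mem_filter.2 ⟨A.meet_mem_flats B, ?_⟩
      rw [card_localization, hB1, hB2]
    · intro X hX
      obtain ⟨hX1, hX2⟩ := Finset.mem_filter.1 hX
      refine Finset.mem_filter.2 ⟨Finset.mem_univ _, ?_, ?_⟩
      · rw [A.meet_above hX1]
      · rw [A.meet_above hX1, hX2, card_localization]
    · intro B hB
      exact (Finset.mem_filter.1 hB).2.1
    · intro X hX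
      exact A.meet_above (Finset.mem_filter.1 hX).1
    · intro B hB
      obtain ⟨-, hB1, hB2⟩ := Finset.mem_filter.1 hB
      rw [card_cubeAt hB1 hB2, hB2]
  · intro B _ hB
    by_contra h
    exact hB (by rw [card_cubeAt_eq_zero h, zero_mul])

/-- On a face with support X exactly the forms of A_X vanish, so the face is the sign pattern of the
remaining ones. -/
theorem faceCount_eq_ncard {X : Submodule ℝ V} (hX : X ∈ A.flats) [DecidableEq A.hyperplanes] :
    A.faceCount X = (signPatterns A.form X (Finset.univ \ A.above X)).ncard := by
  rw [faceCount, ← Nat.card_coe_set_eq]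
  have hrep : ∀ F : A.Face, ∃ x, Quotient.mk A.faceSetoid x = F := Quotient.exists_rep
  choose pt hpt using hrep
  have hsupp : ∀ F : {F : A.Face // F.support = X}, ∀ H, A.form H (pt F.1) = 0 ↔ H ∈ A.above X :=
    fun F => (support_mk_eq_iff hX _).1 (by rw [hpt]; exact F.2)
  let g : {F : A.Face // F.support = X} → signPatterns A.form X (Finset.univ \ A.above X) :=
    fun F => ⟨fun H => SignType.sign (A.form H (pt F.1)), fun H => by
      rw [Ne, sign_eq_zero_iff, hsupp F]; simp, pt F.1,
        (A.meet_above hX).le (A.mem_meet.2 fun H hH => (hsupp F H).2 hH), fun _ _ => rfl⟩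
  refine Nat.card_congr (Equiv.ofBijective g ⟨fun F F' h => Subtype.ext ?_, ?_⟩)
  · rw [← hpt F.1, ← hpt F'.1]
    exact (A.mk_eq_mk_iff _ _).2 (congr_fun (congr_arg Subtype.val h))
  · rintro ⟨σ, h1, x, hx, hxs⟩
    have hx0 : ∀ H ∈ A.above X, A.form H x = 0 := fun H hH =>
      (A.mem_iff_form H x).1 (A.mem_above.1 hH hx)
    have hxσ : ∀ H, SignType.sign (A.form H x) = σ H := fun H => by
      by_cases hH : H ∈ A.above X
      · rw [hx0 H hH, sign_zero, eq_comm]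
        exact not_not.1 (mt (h1 H).1 (by simpa using hH))
      · exact hxs H (by simpa using hH)
    have hF : Face.support (Quotient.mk A.faceSetoid x : A.Face) = X := by
      rw [support_mk_eq_iff hX]
      intro H
      rw [← sign_eq_zero_iff, hxσ, ← not_iff_not, ← Ne.eq_def, h1]
      simp
    refine ⟨⟨_, hF⟩, Subtype.ext (funext fun H => ?_)⟩
    change SignType.sign (A.form H (pt (Quotient.mk A.faceSetoid x))) = σ H
    rw [← hxσ]
    exact (A.mk_eq_mk_iff _ _).1 (hpt _) H

theorem coe_mem_flats (H : A.hyperplanes) : H.1 ∈ A.flats := by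
  have := A.meet_mem_flats {H}
  rwa [meet, Finset.inf_singleton] at this

theorem inf_meet_mem_flats {X : Submodule ℝ V} (hX : X ∈ A.flats) (B : Finset A.hyperplanes) :
    X ⊓ A.meet B ∈ A.flats := by
  classical
  rw [← A.meet_above hX, meet, meet, ← Finset.inf_union]
  exact A.meet_mem_flats _

theorem rank_eq_one (H : A.hyperplanes) : rank H.1 = 1 := A.codim_eq_one H.1 H.2

theorem le_inf_meet_iff {X Y : Submodule ℝ V} {B : Finset A.hyperplanes} :
    Y ≤ X ⊓ A.meet B ↔ Y ≤ X ∧ ∀ H ∈ B, Y ≤ H.1 := by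
  rw [le_inf_iff, meet, Finset.le_inf_iff]

theorem mem_booleanFlats {X : Submodule ℝ V} :
    X ∈ A.booleanFlats ↔ X ∈ A.flats ∧ rank X = (A.above X).card := by
  rw [booleanFlats, Finset.mem_filter, card_localization]

section Lattice

variable [FiniteDimensional ℝ V]

theorem rank_add_finrank (X : Submodule ℝ V) :
    rank X + Module.finrank ℝ X = Module.finrank ℝ V := Submodule.finrank_quotient_add_finrank X

theorem rank_lt_rank {X Y : Submodule ℝ V} (h : X < Y) : rank Y < rank X := by
  have := Submodule.finrank_lt_finrank_of_lt h
  have h1 := rank_add_finrank X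
  have h2 := rank_add_finrank Y
  omega

/-- In Whitney's exponents dimensions may be replaced by codimensions without changing parity,
leaving only lattice data. -/
theorem faceCount_eq_sum {X : Submodule ℝ V} (hX : X ∈ A.flats) [DecidableEq A.hyperplanes] :
    (A.faceCount X : ℤ) = ∑ B ∈ (Finset.univ \ A.above X).powerset,
      (-1) ^ (B.card + (rank X + rank (X ⊓ A.meet B))) := by
  rw [A.faceCount_eq_ncard hX, ncard_signPatterns]
  refine Finset.sum_congr rfl fun B _ => ?_
  have : (B.inf fun i => LinearMap.ker (A.form i)) = A.meet B := by
    simp_rw [ker_form]; rfl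
  rw [this, pow_add, pow_add (-1 : ℤ) B.card]
  congr 1
  apply neg_one_pow_congr
  have h1 := rank_add_finrank X
  have h2 := rank_add_finrank (X ⊓ A.meet B)
  rw [Nat.even_iff, Nat.even_iff]
  omega

/-- For a minimal flat Y strictly containing X, some hyperplane through X does not contain Y;
minimality makes it cut Y exactly in X. -/
theorem exists_flat_covering {X : Submodule ℝ V} (hX : X ∈ A.flats) (hne : X ≠ ⊤) :
    ∃ Y ∈ A.flats, X < Y ∧ rank X = rank Y + 1 := by
  classical
  have htop : (⊤ : Submodule ℝ V) ∈ A.flats := A.meet_mem_flats ∅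
  obtain ⟨Y, hY⟩ := (A.flats.filter (X < ·)).exists_minimal
    ⟨⊤, Finset.mem_filter.2 ⟨htop, lt_top_iff_ne_top.2 hne⟩⟩
  obtain ⟨hYf, hXY⟩ := Finset.mem_filter.1 hY.1
  obtain ⟨H, hH, hYH⟩ : ∃ H ∈ A.above X, ¬ Y ≤ H.1 := by
    by_contra! h
    refine hXY.not_ge ?_
    rw [← A.meet_above hX]
    exact Finset.le_inf h
  have hXH := A.mem_above.1 hH
  have hmem := A.inf_meet_mem_flats hYf {H}
  rw [meet, Finset.inf_singleton] at hmem
  have hXeq : X = Y ⊓ H.1 := by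
    by_contra hne'
    have h1 : X < Y ⊓ H.1 := lt_of_le_of_ne (le_inf hXY.le hXH) hne'
    exact hYH ((hY.2 (Finset.mem_filter.2 ⟨hmem, h1⟩) inf_le_left).trans inf_le_right)
  refine ⟨Y, hYf, hXY, ?_⟩
  obtain ⟨z, hz, hzH⟩ := Set.not_subset.1 hYH
  have h1 := finrank_inf_ker_add_one hz (mt (A.mem_iff_form H z).2 hzH)
  rw [ker_form, ← hXeq] at h1
  have h2 := rank_add_finrank X
  have h3 := rank_add_finrank Y
  omega

theorem mem_hyperplanes_of_rank {X : Submodule ℝ V} (hX : X ∈ A.flats) (h : rank X = 1) :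
    X ∈ A.hyperplanes := by
  have hne : (A.above X).Nonempty := by
    by_contra h0
    rw [Finset.not_nonempty_iff_eq_empty] at h0
    have h1 := A.meet_above hX
    rw [h0, meet, Finset.inf_empty] at h1
    rw [← h1, rank, Module.finrank_zero_of_subsingleton] at h
    omega
  obtain ⟨H, hH⟩ := hne
  rcases (A.mem_above.1 hH).eq_or_lt with h1 | h1
  · rw [h1]; exact H.2
  · have := rank_lt_rank h1
    rw [h, rank_eq_one] at this
    omega

variable {A} {V' : Type*} [AddCommGroup V'] [Module ℝ V'] [FiniteDimensional ℝ V']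
  {A' : RealArrangement V'} (φ : A.flats ≃o A'.flats)

/-- Climb from X to V in steps of rank one; the images are strict inclusions, each costing at least
one. Applied to `φ.symm` this gives equality. -/
theorem rank_le_rank_map (X : A.flats) : rank X.1 ≤ rank (φ X).1 := by
  induction h : rank X.1 generalizing X with
  | zero => exact Nat.zero_le _
  | succ n ih =>
    have hne : X.1 ≠ ⊤ := fun h1 => by
      rw [h1, rank, Module.finrank_zero_of_subsingleton] at h
      omega
    obtain ⟨Y, hY, hXY, hr⟩ := A.exists_flat_covering X.2 hne
    have h1 := ih ⟨Y, hY⟩ (by simp only; omega)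
    have h2 : (φ X).1 < (φ ⟨Y, hY⟩).1 := φ.lt_iff_lt.2 hXY
    have h3 := rank_lt_rank h2
    omega

theorem rank_map (X : A.flats) : rank (φ X).1 = rank X.1 := by
  refine le_antisymm ?_ (rank_le_rank_map φ X)
  simpa using rank_le_rank_map φ.symm (φ X)

/-- The bijection of hyperplanes induced by an isomorphism of intersection lattices. -/
def hyperplaneEquiv : A.hyperplanes ≃ A'.hyperplanes where
  toFun H := ⟨(φ ⟨H.1, A.coe_mem_flats H⟩).1, A'.mem_hyperplanes_of_rank (φ _).2 (by
    rw [rank_map, rank_eq_one])⟩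
  invFun H := ⟨(φ.symm ⟨H.1, A'.coe_mem_flats H⟩).1, A.mem_hyperplanes_of_rank (φ.symm _).2 (by
    rw [rank_map, rank_eq_one])⟩
  left_inv H := by simp
  right_inv H := by simp

theorem le_hyperplaneEquiv_iff (X : A.flats) (H : A.hyperplanes) :
    (φ X).1 ≤ (hyperplaneEquiv φ H).1 ↔ X.1 ≤ H.1 :=
  φ.le_iff_le (x := X) (y := ⟨H.1, A.coe_mem_flats H⟩)

theorem above_map (X : A.flats) :
    A'.above (φ X).1 = (A.above X.1).map (hyperplaneEquiv φ).toEmbedding := by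
  ext H
  obtain ⟨K, rfl⟩ := (hyperplaneEquiv φ).surjective H
  rw [mem_above, le_hyperplaneEquiv_iff]
  simp [mem_above]

theorem inf_meet_map (X : A.flats) (B : Finset A.hyperplanes) :
    (φ ⟨X.1 ⊓ A.meet B, A.inf_meet_mem_flats X.2 B⟩).1 =
      (φ X).1 ⊓ A'.meet (B.map (hyperplaneEquiv φ).toEmbedding) := by
  have key : φ ⟨X.1 ⊓ A.meet B, A.inf_meet_mem_flats X.2 B⟩ =
      ⟨(φ X).1 ⊓ A'.meet (B.map (hyperplaneEquiv φ).toEmbedding),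
        A'.inf_meet_mem_flats (φ X).2 _⟩ := by
    refine eq_of_forall_le_iff fun Z => ?_
    obtain ⟨Y, rfl⟩ := φ.surjective Z
    rw [φ.le_iff_le, ← Subtype.coe_le_coe, ← Subtype.coe_le_coe, le_inf_meet_iff,
      le_inf_meet_iff]
    simp only [Finset.forall_mem_map, Equiv.coe_toEmbedding, le_hyperplaneEquiv_iff,
      Subtype.coe_le_coe, φ.le_iff_le]
  rw [key]

theorem faceCount_map (X : A.flats) : A'.faceCount (φ X).1 = A.faceCount X.1 := by
  classical
  have h : (A'.faceCount (φ X).1 : ℤ) = A.faceCount X.1 := by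
    rw [faceCount_eq_sum A' (φ X).2, faceCount_eq_sum A X.2, above_map]
    symm
    refine Finset.sum_nbij' (fun B => B.map (hyperplaneEquiv φ).toEmbedding)
      (fun B => B.map (hyperplaneEquiv φ).symm.toEmbedding) ?_ ?_ ?_ ?_ ?_
    · intro B hB
      rw [Finset.mem_powerset] at hB ⊢
      intro H hH
      obtain ⟨K, hK, rfl⟩ := Finset.mem_map.1 hH
      simpa using hB hK
    · intro B hB
      rw [Finset.mem_powerset] at hB ⊢
      intro H hH
      obtain ⟨K, hK, rfl⟩ := Finset.mem_map.1 hH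
      have := hB hK
      simp only [Finset.mem_sdiff, Finset.mem_univ, true_and, Finset.mem_map] at this ⊢
      exact fun h => this ⟨_, h, by simp⟩
    · intro B _
      simp [Finset.map_map]
    · intro B _
      simp [Finset.map_map]
    · intro B _
      rw [Finset.card_map, ← inf_meet_map, rank_map, rank_map]
  exact_mod_cast h

/-- Flats are ordered by inclusion here; reversing both orders yields the same isomorphisms. -/
theorem beta_eq_of_orderIso (φ : A.flats ≃o A'.flats) (ℓ : ℕ) : A.beta ℓ ℓ = A'.beta ℓ ℓ := by
  rw [(A.diagonal_MH ℓ).2.2, (A'.diagonal_MH ℓ).2.2]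
  refine Finset.sum_bij' (fun X hX => (φ ⟨X, (A.mem_booleanFlats.1 hX).1⟩).1)
    (fun X hX => (φ.symm ⟨X, (A'.mem_booleanFlats.1 hX).1⟩).1) ?_ ?_ ?_ ?_ ?_
  · intro X hX
    rw [mem_booleanFlats, rank_map, above_map, Finset.card_map]
    exact ⟨(φ _).2, (A.mem_booleanFlats.1 hX).2⟩
  · intro X hX
    rw [mem_booleanFlats, rank_map, above_map, Finset.card_map]
    exact ⟨(φ.symm _).2, (A'.mem_booleanFlats.1 hX).2⟩
  · intro X hX
    simp
  · intro X hX
    simp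
  · intro X hX
    rw [rank_map, faceCount_map]

end Lattice

end RealArrangement

/-! ### Polynomial growth and interior homology. -/

namespace RealArrangement

open MagnitudeHomology

variable {V : Type*} [AddCommGroup V] [Module ℝ V] (A : RealArrangement V)

/-- A real vector space is not a finite union of proper subspaces, so X has a point off all other
hyperplanes. -/
theorem faceCount_pos {X : Submodule ℝ V} (hX : X ∈ A.flats) : 0 < A.faceCount X := by
  classical
  rw [A.faceCount_eq_ncard hX, Set.ncard_pos (Set.toFinite _)]
  obtain ⟨x, hx⟩ : ∃ x : X, ∀ H ∈ Finset.univ \ A.above X, A.form H x ≠ 0 := by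
    have h := Subspace.biUnion_ne_univ_of_top_notMem (k := ℝ) (E := X)
      (s := (Finset.univ \ A.above X).image fun H => LinearMap.ker ((A.form H).domRestrict X)) (by
        intro h
        obtain ⟨H, hH, h⟩ := Finset.mem_image.1 h
        refine (Finset.mem_sdiff.1 hH).2 (A.mem_above.2 fun z hz => (A.mem_iff_form H z).2 ?_)
        have : (⟨z, hz⟩ : X) ∈ LinearMap.ker ((A.form H).domRestrict X) := by rw [h]; trivial
        exact this)
    obtain ⟨x, hx⟩ := (Set.ne_univ_iff_exists_notMem _).1 h
    refine ⟨x, fun H hH h0 => hx ?_⟩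
    simp only [Set.mem_iUnion]
    exact ⟨_, Finset.mem_image_of_mem _ hH, h0⟩
  refine ⟨fun H => if H ∈ Finset.univ \ A.above X then SignType.sign (A.form H x) else 0,
    fun H => ?_, x, x.2, fun H hH => ?_⟩
  · by_cases hH : H ∈ Finset.univ \ A.above X
    · simp only [if_pos hH]
      exact ⟨fun _ => hH, fun _ => mt sign_eq_zero_iff.1 (hx H hH)⟩
    · simp only [if_neg hH]
      exact ⟨fun h => absurd rfl h, fun h => absurd h hH⟩
  · simp only [if_pos hH]

theorem coe_mem_booleanFlats [FiniteDimensional ℝ V] (H : A.hyperplanes) :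
    H.1 ∈ A.booleanFlats := by
  have h : A.above H.1 = {H} := by
    ext K
    rw [mem_above, Finset.mem_singleton]
    constructor
    · intro h
      rcases h.eq_or_lt with h | h
      · exact Subtype.ext h.symm
      · have := rank_lt_rank h
        rw [rank_eq_one, rank_eq_one] at this
        omega
    · rintro rfl
      exact le_rfl
  rw [mem_booleanFlats, h, rank_eq_one]
  exact ⟨A.coe_mem_flats H, rfl⟩

/-- The polynomial `t ↦ (t - 1 choose r)`. -/
noncomputable def choosePoly (r : ℕ) : Polynomial ℚ :=
  Polynomial.C ((r.factorial : ℚ)⁻¹) *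
    (descPochhammer ℚ r).comp (Polynomial.X - Polynomial.C 1)

theorem eval_choosePoly {ℓ : ℕ} (hℓ : 1 ≤ ℓ) (r : ℕ) :
    (choosePoly r).eval (ℓ : ℚ) = ((ℓ - 1).choose r : ℚ) := by
  have h : ((ℓ : ℚ) - 1) = ((ℓ - 1 : ℕ) : ℚ) := by push_cast [Nat.cast_sub hℓ]; ring
  rw [choosePoly, Polynomial.eval_mul, Polynomial.eval_C, Polynomial.eval_comp,
    Polynomial.eval_sub, Polynomial.eval_X, Polynomial.eval_C, h,
    descPochhammer_eval_eq_descFactorial, Nat.descFactorial_eq_factorial_mul_choose]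
  push_cast
  rw [inv_mul_cancel_left₀]
  exact_mod_cast Nat.factorial_ne_zero r

theorem natDegree_choosePoly_le (r : ℕ) : (choosePoly r).natDegree ≤ r := by
  refine (Polynomial.natDegree_C_mul_le _ _).trans ?_
  rw [Polynomial.natDegree_comp, descPochhammer_natDegree, Polynomial.natDegree_X_sub_C, mul_one]

theorem coeff_choosePoly_self (r : ℕ) : (choosePoly r).coeff r = (r.factorial : ℚ)⁻¹ := by
  have hm := ((monic_descPochhammer ℚ r).comp_X_sub_C 1).coeff_natDegree
  have hd : ((descPochhammer ℚ r).comp (Polynomial.X - Polynomial.C 1)).natDegree = r := by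
    rw [Polynomial.natDegree_comp, descPochhammer_natDegree, Polynomial.natDegree_X_sub_C,
      mul_one]
  rw [hd] at hm
  rw [choosePoly, Polynomial.coeff_C_mul, hm, mul_one]

theorem beta_eq_sum_binom {ℓ : ℕ} (hℓ : 1 ≤ ℓ) : A.beta ℓ ℓ = ∑ X ∈ A.booleanFlats,
    A.faceCount X * 2 ^ rank X * binom (ℓ - 1) ((rank X : ℤ) - 1) := by
  simp_rw [← surjCount_eq_binom hℓ]
  exact (A.diagonal_MH ℓ).2.2

theorem exists_beta_polynomial [FiniteDimensional ℝ V] (hA : A.hyperplanes.Nonempty) :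
    ∃ p : Polynomial ℚ, p.degree = ((A.dMax - 1 : ℕ) : WithBot ℕ) ∧
      ∀ ℓ : ℕ, 1 ≤ ℓ → (A.beta ℓ ℓ : ℚ) = p.eval (ℓ : ℚ) := by
  obtain ⟨H, hH⟩ := hA
  have hHb := A.coe_mem_booleanFlats ⟨H, hH⟩
  have hle : ∀ X ∈ A.booleanFlats, rank X ≤ A.dMax := fun X hX =>
    Finset.le_sup (f := rank) hX
  have hd : 1 ≤ A.dMax := (rank_eq_one A ⟨H, hH⟩).symm.le.trans (hle _ hHb)
  obtain ⟨X₀, hX₀, hX₀d⟩ := Finset.exists_mem_eq_sup A.booleanFlats ⟨_, hHb⟩ rank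
  change A.dMax = rank X₀ at hX₀d
  -- The flat V is dropped because its binomial has lower index -1. Leading coefficients are
  -- positive, so the terms of top rank cannot cancel.
  refine ⟨∑ X ∈ A.booleanFlats with 1 ≤ rank X,
    Polynomial.C ((A.faceCount X : ℚ) * 2 ^ rank X) * choosePoly (rank X - 1), ?_, ?_⟩
  · apply Polynomial.degree_eq_of_le_of_coeff_ne_zero
    · refine (Polynomial.degree_sum_le _ _).trans (Finset.sup_le fun X hX => ?_)
      have h1 := hle X (Finset.mem_filter.1 hX).1
      refine Polynomial.degree_le_of_natDegree_le ?_
      refine (Polynomial.natDegree_C_mul_le _ _).trans ((natDegree_choosePoly_le _).trans ?_)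
      omega
    · rw [Polynomial.finsetSum_coeff]
      refine (Finset.sum_pos' (fun X hX => ?_) ⟨X₀, ?_, ?_⟩).ne'
      · rw [Polynomial.coeff_C_mul]
        have h1 := hle X (Finset.mem_filter.1 hX).1
        refine mul_nonneg (by positivity) ?_
        rcases (Nat.sub_le_sub_right h1 1).eq_or_lt with h | h
        · rw [← h, coeff_choosePoly_self]
          positivity
        · rw [Polynomial.coeff_eq_zero_of_natDegree_lt
            ((natDegree_choosePoly_le _).trans_lt h)]
      · rw [Finset.mem_filter]
        exact ⟨hX₀, hX₀d ▸ hd⟩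
      · rw [Polynomial.coeff_C_mul, hX₀d, coeff_choosePoly_self]
        have := A.faceCount_pos (A.mem_booleanFlats.1 hX₀).1
        positivity
  · intro ℓ hℓ
    rw [A.beta_eq_sum_binom hℓ, Polynomial.eval_finsetSum, Finset.sum_filter]
    push_cast
    refine Finset.sum_congr rfl fun X _ => ?_
    unfold binom
    split_ifs with h1 h2 h2
    · omega
    · simp
    · rw [Polynomial.eval_mul, Polynomial.eval_C, eval_choosePoly hℓ]
      congr 3
      omega
    · omega

open Classical in
/-- The diagonal interior magnitude homology is free of finite rank. -/
theorem diagonal_interiorMH (ℓ : ℕ) : Module.Free ℤ (A.interiorMH ℓ ℓ) ∧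
    Module.Finite ℤ (A.interiorMH ℓ ℓ) ∧ A.interiorBeta ℓ ℓ =
      ∑ B : Finset A.hyperplanes with A.meet B = A.meet Finset.univ,
        Nat.card {C : A.Chamber // CubeAt A.tope C B} * surjCount ℓ B.card := by
  have huniv : A.meet Finset.univ = A.hyperplanes.inf id := by
    unfold meet
    apply le_antisymm
    · exact Finset.le_inf fun H hH =>
        Finset.inf_le (f := Subtype.val) (Finset.mem_univ (⟨H, hH⟩ : A.hyperplanes))
    · exact Finset.le_inf fun H _ => Finset.inf_le (f := id) H.2
  -- Interiority depends only on the set of letters, so it fits the condition Q on supports.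
  have h := diagonal_homology (p := A.tope) (G := A.topeGraph)
    (P := A.interiorChains ℓ) (ℓ := ℓ) (Q := fun B => A.meet B = A.meet Finset.univ)
    tope_injective adj_iff ?_ ?_
  · refine ⟨h.1, h.2.1, h.2.2.trans ?_⟩
    rw [card_diagIndex]
  · intro x
    have hQ : ∀ w : Fin ℓ → A.hyperplanes, Trace A.tope x w →
        ((A.crossed x).inf id = A.hyperplanes.inf id ↔
          A.meet (Finset.univ.image w) = A.meet Finset.univ) := by
      intro w hw
      rw [crossed_eq hw, huniv, Finset.inf_image]
      rfl
    change x ∈ properChains A.topeGraph ℓ ℓ ∧ _ ↔ _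
    rw [mem_properChains_iff]
    constructor
    · rintro ⟨⟨w, hw⟩, h⟩
      exact ⟨w, hw, (hQ w hw).1 h⟩
    · rintro ⟨w, hw, h⟩
      exact ⟨⟨w, hw⟩, (hQ w hw).2 h⟩
  · rw [Set.eq_empty_iff_forall_notMem]
    intro x hx
    have := hx.1
    rw [properChains_succ_eq_empty] at this
    exact this

theorem mem_boolean_hyperplanes {d : ℕ} {H : Submodule ℝ (Fin d → ℝ)} :
    H ∈ (boolean d).hyperplanes ↔
      ∃ i, LinearMap.ker (LinearMap.proj (R := ℝ) (φ := fun _ : Fin d => ℝ) i) = H := by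
  simp [boolean]

theorem card_boolean_hyperplanes (d : ℕ) : (boolean d).hyperplanes.card = d := by
  classical
  have hinj : Function.Injective fun i : Fin d =>
      LinearMap.ker (LinearMap.proj (R := ℝ) (φ := fun _ : Fin d => ℝ) i) := by
    intro i j hij
    by_contra hne
    have h1 : (Pi.single i 1 : Fin d → ℝ) ∈
        LinearMap.ker (LinearMap.proj (R := ℝ) (φ := fun _ : Fin d => ℝ) j) := by
      simp [hne]
    simp only at hij
    rw [← hij] at h1
    simp at h1
  have h2 : (boolean d).hyperplanes = Finset.univ.image fun i : Fin d =>
      LinearMap.ker (LinearMap.proj (R := ℝ) (φ := fun _ : Fin d => ℝ) i) := by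
    ext H
    simp [mem_boolean_hyperplanes]
  rw [h2, Finset.card_image_of_injective _ hinj, Finset.card_fin]

theorem meet_boolean_univ (d : ℕ) : (boolean d).meet Finset.univ = ⊥ := by
  rw [eq_bot_iff]
  intro x hx
  rw [Submodule.mem_bot]
  ext i
  have h : (boolean d).meet Finset.univ ≤ _ := Finset.inf_le (f := Subtype.val)
    (Finset.mem_univ (⟨_, mem_boolean_hyperplanes.2 ⟨i, rfl⟩⟩ : (boolean d).hyperplanes))
  exact h hx

/-- If the i-th coordinate hyperplane is omitted, the i-th basis vector survives in the
intersection. -/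
theorem meet_boolean_eq_bot_iff {d : ℕ} {B : Finset (boolean d).hyperplanes} :
    (boolean d).meet B = ⊥ ↔ B = Finset.univ := by
  constructor
  · intro h
    rw [Finset.eq_univ_iff_forall]
    rintro ⟨H, hH⟩
    obtain ⟨i, rfl⟩ := mem_boolean_hyperplanes.1 hH
    by_contra hB
    have h1 : (Pi.single i 1 : Fin d → ℝ) ∈ (boolean d).meet B := by
      unfold meet
      rw [Submodule.mem_finsetInf]
      rintro ⟨K, hK⟩ hKB
      obtain ⟨j, rfl⟩ := mem_boolean_hyperplanes.1 hK
      have hne : i ≠ j := by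
        rintro rfl
        exact hB hKB
      simp [hne]
    rw [h, Submodule.mem_bot] at h1
    have := congr_fun h1 i
    simp at this
  · rintro rfl
    exact meet_boolean_univ d

theorem diagonal_interiorMH_boolean (d ℓ : ℕ) (hℓ : 1 ≤ ℓ) :
    Module.Free ℤ ((boolean d).interiorMH ℓ ℓ) ∧ Module.Finite ℤ ((boolean d).interiorMH ℓ ℓ) ∧
      (boolean d).interiorBeta ℓ ℓ = 2 ^ d * binom (ℓ - 1) ((d : ℤ) - 1) := by
  classical
  obtain ⟨h1, h2, h3⟩ := (boolean d).diagonal_interiorMH ℓ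
  refine ⟨h1, h2, h3.trans ?_⟩
  have hcard : (Finset.univ : Finset (boolean d).hyperplanes).card = d := by
    rw [Finset.card_univ, Fintype.card_coe, card_boolean_hyperplanes]
  have hrank : rank ((boolean d).meet Finset.univ) =
      (Finset.univ : Finset (boolean d).hyperplanes).card := by
    have := rank_add_finrank ((boolean d).meet Finset.univ)
    rw [hcard]
    rw [meet_boolean_univ] at this ⊢
    simpa using this
  have habove : (boolean d).above ((boolean d).meet Finset.univ) = Finset.univ := by
    ext H
    rw [mem_above, meet_boolean_univ]
    simp
  have hface : (boolean d).faceCount ((boolean d).meet Finset.univ) = 1 := by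
    rw [faceCount_eq_ncard _ ((boolean d).meet_mem_flats _), habove, sdiff_self]
    exact (congr_arg Set.ncard (signPatterns_empty _)).trans (Set.ncard_singleton _)
  have hfilter : (Finset.univ.filter fun B : Finset (boolean d).hyperplanes =>
      (boolean d).meet B = (boolean d).meet Finset.univ) = {Finset.univ} := by
    ext B
    rw [meet_boolean_univ]
    simp [meet_boolean_eq_bot_iff]
  rw [← surjCount_eq_binom hℓ]
  calc _ = ∑ B ∈ {(Finset.univ : Finset (boolean d).hyperplanes)},
        Nat.card {C : (boolean d).Chamber // CubeAt (boolean d).tope C B} *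
          surjCount ℓ B.card := by
        rw [← hfilter]
    _ = _ := by
        rw [Finset.sum_singleton, card_cubeAt habove hrank, hface, hcard, one_mul]

end RealArrangement

theorem corollary5 {V : Type*} [AddCommGroup V] [Module ℝ V] [FiniteDimensional ℝ V]
    (A : RealArrangement V) :
    -- the diagonal magnitude homology is free abelian of finite rank
    (∀ ℓ : ℕ, Module.Free ℤ (A.MH ℓ ℓ) ∧ Module.Finite ℤ (A.MH ℓ ℓ)) ∧
    -- the formula for its rank
    (∀ ℓ : ℕ, 1 ≤ ℓ →
      A.beta ℓ ℓ = ∑ X ∈ A.booleanFlats,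
        A.faceCount X * 2 ^ RealArrangement.rank X *
          binom (ℓ - 1) ((RealArrangement.rank X : ℤ) - 1)) ∧
    -- it is determined by the intersection lattice
    (∀ {V' : Type*} [AddCommGroup V'] [Module ℝ V'] [FiniteDimensional ℝ V']
      (A' : RealArrangement V'), Nonempty (A.flats ≃o A'.flats) →
        ∀ ℓ : ℕ, A.beta ℓ ℓ = A'.beta ℓ ℓ) ∧
    -- polynomial growth of degree `d_max - 1`
    (A.hyperplanes.Nonempty → ∃ p : Polynomial ℚ,
      p.degree = ((A.dMax - 1 : ℕ) : WithBot ℕ) ∧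
        ∀ ℓ : ℕ, 1 ≤ ℓ → (A.beta ℓ ℓ : ℚ) = p.eval (ℓ : ℚ)) ∧
    -- the interior magnitude homology of the Boolean arrangements
    (∀ d ℓ : ℕ, 1 ≤ ℓ →
      Module.Free ℤ ((RealArrangement.boolean d).interiorMH ℓ ℓ) ∧
      Module.Finite ℤ ((RealArrangement.boolean d).interiorMH ℓ ℓ) ∧
      (RealArrangement.boolean d).interiorBeta ℓ ℓ = 2 ^ d * binom (ℓ - 1) ((d : ℤ) - 1)) := by
  refine ⟨fun ℓ => ⟨(A.diagonal_MH ℓ).1, (A.diagonal_MH ℓ).2.1⟩,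
    fun ℓ hℓ => A.beta_eq_sum_binom hℓ, ?_, A.exists_beta_polynomial,
    RealArrangement.diagonal_interiorMH_boolean⟩
  rintro V' _ _ _ A' ⟨φ⟩ ℓ
  exact RealArrangement.beta_eq_of_orderIso φ ℓ
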